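/- Let $K\subset\mathbb C$ be a finite set contained in the closed unit disc, and let $\sigma:K^{\mathbb N}\to K^{\mathbb N}$, $(\sigma x)_n=x_{n+1}$, be the shift on the space of one-sided sequences $x=(x_1,x_2,\dots)$ over $K$ with the product topology. A *shift-invariant measure* is a $\sigma$-invariant Borel probability measure on $K^{\mathbb N}$. A *joining* of two shift-invariant measures $\mu,\nu$ is a $(\sigma\times\sigma)$-invariant Borel probability measure $\xi$ on $K^{\mathbb N}\times K^{\mathbb N}$ with marginals $\mu$ and $\nu$. The *correlation* of $\mu$ and $\nu$ is $$\operatorname{Corr}(\mu,\nu)=\sup_{\xi}\left|\int x_1\overline{y_1}\,d\xi(x,y)-\int x_1\,d\mu(x)\cdot\int\overline{y_1}\,d\nu(y)\right|,$$ where $\xi$ ranges over all joinings of $\mu$ and $\nu$; the measures $\mu$ and $\nu$ are *correlated* if $\operatorname{Corr}(\mu,\nu)\neq0$. A *subshift* is a non-empty closed set $X\subset K^{\mathbb N}$ with $\sigma(X)\subset X$; it is *strictly ergodic* if it is minimal (contains no strictly smaller subshift) and carries exactly one shift-invariant probability measure. A shift-invariant measure is *strictly ergodic* if its topological support is a strictly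 ergodic subshift. **Theorem.** Let $\mu$ be a shift-invariant measure on $K^{\mathbb N}$. Then $\mu$ is correlated to some strictly ergodic shift-invariant measure on $K^{\mathbb N}$ if and only if $\mu$ is correlated to some ergodic shift-invariant measure on $K^{\mathbb N}$. -/

import Mathlib

open MeasureTheory

/-- The one-sided full shift space over the finite alphabet `K ⊆ ℂ`, with the product topology and
the product (i.e. Borel) σ-algebra. Sequences are enumerated from `0`, so `x 0` is the first symbol
of `x`. -/
abbrev FullShift (K : Finset ℂ) : Type := ℕ → K

/-- The shift transformation, deleting the first symbol. -/
def shift (K : Finset ℂ) (x : FullShift K) : FullShift K := fun n => x (n + 1)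

/-- Shift-invariant Borel probability measures. -/
structure IsShiftInvariant {K : Finset ℂ} (μ : Measure (FullShift K)) : Prop where
  isProbabilityMeasure : IsProbabilityMeasure μ
  measurePreserving : MeasurePreserving (shift K) μ μ

/-- `ξ` is a joining of `μ` and `ν`: a probability measure on the Cartesian square of the shift
space, invariant under the product of the shifts, with marginals `μ` and `ν`. -/
structure IsJoining {K : Finset ℂ} (ξ : Measure (FullShift K × FullShift K))
    (μ ν : Measure (FullShift K)) : Prop where
  isProbabilityMeasure : IsProbabilityMeasure ξ
  measurePreserving : MeasurePreserving (Prod.map (shift K) (shift K)) ξ ξ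
  map_fst : ξ.map Prod.fst = μ
  map_snd : ξ.map Prod.snd = ν

/-- The correlation of two shift-invariant measures: the supremum over all joinings `ξ` of
`|∫ x₁ conj(y₁) dξ - ∫ x₁ dμ * ∫ conj(y₁) dν|`. For shift-invariant `μ` and `ν` the set of joinings
is non-empty (it contains the product measure) and the values are bounded, as `K` is finite. -/
noncomputable def corr {K : Finset ℂ} (μ ν : Measure (FullShift K)) : ℝ :=
  ⨆ ξ : {ξ : Measure (FullShift K × FullShift K) // IsJoining ξ μ ν},
    ‖(∫ p, (p.1 0 : ℂ) * (starRingEnd ℂ) (p.2 0 : ℂ) ∂ξ.1) -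
      (∫ x, (x 0 : ℂ) ∂μ) * (∫ y, (starRingEnd ℂ) (y 0 : ℂ) ∂ν)‖

/-- Two measures are correlated if their correlation is not zero. -/
def Correlated {K : Finset ℂ} (μ ν : Measure (FullShift K)) : Prop := corr μ ν ≠ 0

/-- A subshift: a non-empty closed set of sequences which is mapped into itself by the shift. -/
structure IsSubshift {K : Finset ℂ} (X : Set (FullShift K)) : Prop where
  nonempty : X.Nonempty
  isClosed : IsClosed X
  mapsTo : Set.MapsTo (shift K) X X

/-- A subshift is strictly ergodic if it is minimal (it contains no smaller subshift) and uniquely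
ergodic (it carries exactly one shift-invariant probability measure). -/
structure IsStrictlyErgodicSubshift {K : Finset ℂ} (X : Set (FullShift K)) : Prop where
  isSubshift : IsSubshift X
  minimal : ∀ Y : Set (FullShift K), IsSubshift Y → Y ⊆ X → Y = X
  uniquelyErgodic : ∃! ρ : Measure (FullShift K), IsShiftInvariant ρ ∧ ρ Xᶜ = 0

/-- Ergodic shift-invariant probability measures. -/
structure IsErgodicMeasure {K : Finset ℂ} (ν : Measure (FullShift K)) : Prop where
  isShiftInvariant : IsShiftInvariant ν
  ergodic : Ergodic (shift K) ν

/-- Strictly ergodic measures: shift-invariant probability measures whose topological support is a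
strictly ergodic subshift. -/
structure IsStrictlyErgodicMeasure {K : Finset ℂ} (ν : Measure (FullShift K)) : Prop where
  isShiftInvariant : IsShiftInvariant ν
  support : IsStrictlyErgodicSubshift ν.support

/-!
A strictly ergodic measure is ergodic, so only the converse has content. Let `ξ` be a joining of `μ`
with an ergodic measure `ν` that witnesses their correlation. It suffices to replace `ν` by a
strictly ergodic measure while changing the integral of a function of `(x, y₁)` only slightly, which
is achieved by recoding the second coordinate.

The recoding is the limit of a sequence of block codes. A block code with words of length about `ℓ`
is refined to one with much longer words by concatenating its words, starting at a suitable phase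
below `2ℓ`. By the mean ergodic theorem for `σ^ℓ` the phase can be chosen so that typical new words
have almost the same frequencies of finitely many given words, while on average few symbols change;
atypical new words are replaced by typical ones. Repeating code words periodically and averaging the
recoded joinings along orbits, one obtains as a weak limit a joining of `μ` with an invariant
measure on a closed set of sequences with uniform word frequencies. Such a set carries at most one
invariant measure, and the integral has hardly moved because the codes are close to the identity in
the normalized Hamming distance.
-/

open Filter Topology

section ErgodicAverages

variable {α : Type*} [MeasurableSpace α] {ν : Measure α} {T : α → α}

theorem coeFn_birkhoffAverage_compMeasurePreserving {E : Type*} [NormedAddCommGroup E]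
    [NormedSpace ℝ E] {p : ENNReal} (hT : MeasurePreserving T ν ν) {f : α → E} (hf : MemLp f p ν)
    (n : ℕ) :
    ⇑(birkhoffAverage ℝ (Lp.compMeasurePreserving T hT) id n (hf.toLp f)) =ᵐ[ν]
      birkhoffAverage ℝ T f n := by
  have iterate_ae : ∀ k, ⇑((Lp.compMeasurePreserving T hT)^[k] (hf.toLp f)) =ᵐ[ν] f ∘ T^[k] := by
    intro k
    rw [Lp.compMeasurePreserving_iterate, Lp.toLp_compMeasurePreserving]
    exact MemLp.coeFn_toLp _
  simp only [birkhoffAverage, birkhoffSum, id]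
  filter_upwards [Lp.coeFn_smul (n : ℝ)⁻¹
      (∑ k ∈ Finset.range n, (Lp.compMeasurePreserving T hT)^[k] (hf.toLp f)),
    Lp.coeFn_fun_finsetSum (Finset.range n)
      fun k => (Lp.compMeasurePreserving T hT)^[k] (hf.toLp f),
    ae_all_iff.2 iterate_ae] with x hsmul hsum hiter
  simp only [hsmul, Pi.smul_apply, hsum, hiter, Function.comp_apply, birkhoffAverage, birkhoffSum]

theorem exists_invariant_tendstoInMeasure_birkhoffAverage [IsFiniteMeasure ν]
    (hT : MeasurePreserving T ν ν) {f : α → ℝ} (hf : MemLp f 2 ν) :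
    ∃ F : α → ℝ, Measurable F ∧ Integrable F ν ∧ F ∘ T =ᵐ[ν] F ∧ ∫ x, F x ∂ν = ∫ x, f x ∂ν ∧
      TendstoInMeasure ν (birkhoffAverage ℝ T f) atTop F := by
  let U : Lp ℝ 2 ν →L[ℝ] Lp ℝ 2 ν := (Lp.compMeasurePreservingₗᵢ ℝ T hT).toContinuousLinearMap
  let P := (U.eqLocus (1 : Lp ℝ 2 ν →L[ℝ] Lp ℝ 2 ν)).orthogonalProjectionOnto (hf.toLp f)
  have mean_ergodic := U.tendsto_birkhoffAverage_orthogonalProjection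
    (LinearIsometry.norm_toContinuousLinearMap_le _) (hf.toLp f)
  let one : Lp ℝ 2 ν := indicatorConstLp 2 MeasurableSet.univ (measure_ne_top ν _) 1
  have integral_eq_inner_one (g : Lp ℝ 2 ν) : ∫ x, g x ∂ν = inner ℝ one g := by
    rw [L2.inner_indicatorConstLp_one, Measure.restrict_univ]
  have one_mem : one ∈ U.eqLocus (1 : Lp ℝ 2 ν →L[ℝ] Lp ℝ 2 ν) :=
    Lp.indicatorConstLp_compMeasurePreserving MeasurableSet.univ (measure_ne_top ν _) 1 hT
  refine ⟨(P : Lp ℝ 2 ν), (Lp.stronglyMeasurable _).measurable,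
    (Lp.memLp _).integrable one_le_two, ?_, ?_, ?_⟩
  · have fixed : Lp.compMeasurePreserving T hT (P : Lp ℝ 2 ν) = P := P.2
    simpa only [fixed] using (Lp.coeFn_compMeasurePreserving (P : Lp ℝ 2 ν) hT).symm
  · rw [integral_eq_inner_one, ← Submodule.coe_inner _ ⟨one, one_mem⟩ P,
      Submodule.inner_orthogonalProjectionOnto_eq_of_mem_left, ← integral_eq_inner_one]
    exact integral_congr_ae hf.coeFn_toLp
  · exact (tendstoInMeasure_of_tendsto_Lp mean_ergodic).congr_left
      (coeFn_birkhoffAverage_compMeasurePreserving hT hf)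

theorem ae_exists_iterate_mem_of_ergodic [IsFiniteMeasure ν] (hT : Ergodic T ν) {ℓ : ℕ} (hℓ : 0 < ℓ)
    {G : Set α} (hGm : MeasurableSet G) (hG : ν G ≠ 0) (hinv : ∀ᵐ x ∂ν, T^[ℓ] x ∈ G → x ∈ G) :
    ∀ᵐ x ∂ν, ∃ i ∈ Finset.Ico ℓ (2 * ℓ), T^[i] x ∈ G := by
  let V : Set α := ⋃ i ∈ Finset.Ico ℓ (2 * ℓ), T^[i] ⁻¹' G
  have hVm : MeasurableSet V :=
    Finset.measurableSet_biUnion _ fun i _ => hT.measurable.iterate i hGm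
  have preimage_le : T ⁻¹' V ≤ᵐ[ν] V := by
    filter_upwards [(hT.toMeasurePreserving.iterate ℓ).quasiMeasurePreserving.ae hinv]
      with x hx hxV
    obtain ⟨i, hi, hxi⟩ := Set.mem_iUnion₂.1 hxV
    rw [Set.mem_preimage, ← Function.iterate_succ_apply] at hxi
    rw [Finset.mem_Ico] at hi
    rcases lt_or_ge (i + 1) (2 * ℓ) with hlt | hge
    · exact Set.mem_biUnion (Finset.mem_Ico.2 ⟨by omega, hlt⟩) hxi
    · refine Set.mem_biUnion (Finset.mem_Ico.2 ⟨le_rfl, by omega⟩) (hx ?_)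
      rwa [← Function.iterate_add_apply, show ℓ + ℓ = i + 1 by omega]
  have hV : ν V ≠ 0 := by
    refine fun h0 => hG ?_
    rw [← (hT.toMeasurePreserving.iterate ℓ).measure_preimage hGm.nullMeasurableSet]
    exact measure_mono_null (Set.subset_biUnion_of_mem (u := fun i => T^[i] ⁻¹' G)
      (Finset.mem_Ico.2 ⟨le_rfl, by omega⟩)) h0
  rcases hT.ae_empty_or_univ_of_preimage_ae_le hVm.nullMeasurableSet preimage_le with h0 | h1
  · exact absurd (ae_eq_empty.1 h0) hV
  · filter_upwards [eventuallyEq_univ.1 h1] with x hx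
    simpa only [Set.mem_iUnion₂, Set.mem_preimage, exists_prop, V] using hx

theorem exists_measure_dist_le_ne_zero {E : Type*} [PseudoMetricSpace E]
    [TopologicalSpace.SeparableSpace E] (f : α → E) {S : Set α} (hS : ν S ≠ 0) {δ : ℝ}
    (hδ : 0 < δ) :
    ∃ q, ν {x ∈ S | dist (f x) q ≤ δ} ≠ 0 := by
  by_contra! h
  obtain ⟨D, hDc, hD⟩ := TopologicalSpace.exists_countable_dense E
  refine hS (measure_mono_null (fun x hx => ?_)
    ((measure_biUnion_null_iff hDc).2 fun q _ => h q))
  obtain ⟨q, hqD, hq⟩ := hD.exists_dist_lt (f x) hδ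
  exact Set.mem_biUnion hqD ⟨hx, hq.le⟩

theorem tendsto_measure_forall_iterate_notMem {β : Type*} {l : Filter β}
    (hT : MeasurePreserving T ν ν) {I : Finset ℕ} {G : Set α}
    (hG : ∀ᵐ x ∂ν, ∃ i ∈ I, T^[i] x ∈ G) {A : β → Set α}
    (hA : Tendsto (fun b => ν (G \ A b)) l (𝓝 0)) :
    Tendsto (fun b => ν {x | ∀ i ∈ I, T^[i] x ∉ A b}) l (𝓝 0) := by
  have measure_le (b : β) : ν {x | ∀ i ∈ I, T^[i] x ∉ A b} ≤ I.card * ν (G \ A b) := calc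
    _ ≤ ν (⋃ i ∈ I, T^[i] ⁻¹' (G \ A b)) := by
      refine measure_mono_ae ?_
      filter_upwards [hG] with x ⟨i, hi, hxi⟩ hx
      exact Set.mem_biUnion hi ⟨hxi, hx i hi⟩
    _ ≤ ∑ i ∈ I, ν (T^[i] ⁻¹' (G \ A b)) := measure_biUnion_finset_le _ _
    _ ≤ ∑ _i ∈ I, ν (G \ A b) := Finset.sum_le_sum fun i _ => (hT.iterate i).measure_preimage_le _
    _ = I.card * ν (G \ A b) := by rw [Finset.sum_const, nsmul_eq_mul]
  refine tendsto_of_tendsto_of_tendsto_of_le_of_le tendsto_const_nhds ?_ (fun _ => zero_le)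
    measure_le
  simpa only [mul_zero] using
    ENNReal.Tendsto.const_mul hA (Or.inr (ENNReal.natCast_ne_top I.card))

theorem tendsto_measure_diff_birkhoffAverage_near {ι : Type*} [Finite ι] {f F : ι → α → ℝ}
    (hF : ∀ j, TendstoInMeasure ν (birkhoffAverage ℝ T (f j)) atTop (F j)) {G : Set α} {q : ι → ℝ}
    {η δ : ℝ} (hG : ∀ x ∈ G, ∀ j, |F j x - q j| ≤ η) (hηδ : η < δ) :
    Tendsto (fun M => ν (G \ {x | ∀ j, |birkhoffAverage ℝ T (f j) M x - q j| ≤ δ})) atTop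
      (𝓝 0) := by
  cases nonempty_fintype ι
  have sum_tendsto : Tendsto
      (fun M => ∑ j, ν {x | δ - η ≤ ‖birkhoffAverage ℝ T (f j) M x - F j x‖}) atTop (𝓝 0) := by
    simpa only [Finset.sum_const_zero] using tendsto_finsetSum Finset.univ fun j _ =>
      tendstoInMeasure_iff_norm.1 (hF j) (δ - η) (sub_pos.2 hηδ)
  refine tendsto_of_tendsto_of_tendsto_of_le_of_le tendsto_const_nhds sum_tendsto
    (fun _ => zero_le) fun M => ?_
  rw [← tsum_fintype (L := .unconditional ι)]
  refine (measure_mono fun x hx => ?_).trans (measure_iUnion_le _)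
  obtain ⟨j, hj⟩ := not_forall.1 hx.2
  refine Set.mem_iUnion.2 ⟨j, ?_⟩
  have htri := abs_sub_le (birkhoffAverage ℝ T (f j) M x) (F j x) (q j)
  have hFj := hG x hx.1 j
  rw [Set.mem_ofPred_eq, Real.norm_eq_abs]
  linarith [not_le.1 hj]

/- `T^[ℓ]` need not be ergodic, so the limit of its averages may depend on the point. The values `p`
are limits on a set of positive measure invariant under `T^[ℓ]`, on which the average of `f j₀` is
at most its integral; by ergodicity of `T` almost every point visits this set at some phase. -/
theorem exists_phase_birkhoffAverage [IsProbabilityMeasure ν] (hT : Ergodic T ν) {ℓ : ℕ}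
    (hℓ : 0 < ℓ) {ι : Type*} [Finite ι] {f : ι → α → ℝ} (hf : ∀ j, MemLp (f j) 2 ν) (j₀ : ι)
    {δ : ℝ} (hδ : 0 < δ) :
    ∃ p : ι → ℝ, p j₀ ≤ ∫ x, f j₀ x ∂ν + δ ∧ Tendsto (fun M => ν {x | ∀ i ∈ Finset.Ico ℓ (2 * ℓ),
      T^[i] x ∉ {y | ∀ j, |birkhoffAverage ℝ T^[ℓ] (f j) M y - p j| ≤ δ}}) atTop (𝓝 0) := by
  have hTℓ := hT.toMeasurePreserving.iterate ℓ
  choose F hFm hFi hFT hFint hF using fun j =>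
    exists_invariant_tendstoInMeasure_birkhoffAverage hTℓ (hf j)
  cases nonempty_fintype ι
  obtain ⟨q, hq⟩ := exists_measure_dist_le_ne_zero (fun x j => F j x)
    (measure_le_integral_pos (hFi j₀)).ne' (half_pos hδ)
  let G : Set α := {x | F j₀ x ≤ ∫ a, F j₀ a ∂ν ∧ dist (fun j => F j x) q ≤ δ / 2}
  have hGm : MeasurableSet G := (measurableSet_le (hFm j₀) measurable_const).inter
    (measurableSet_le ((measurable_pi_iff.2 hFm).dist measurable_const) measurable_const)
  have hGinv : ∀ᵐ x ∂ν, T^[ℓ] x ∈ G → x ∈ G := by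
    filter_upwards [ae_all_iff.2 hFT] with x hx hxG
    have hFx : ∀ j, F j (T^[ℓ] x) = F j x := hx
    simpa only [G, Set.mem_ofPred_eq, hFx] using hxG
  have hGq : ∀ x ∈ G, ∀ j, |F j x - q j| ≤ δ / 2 := fun x hx j =>
    (dist_le_pi_dist (fun j => F j x) q j).trans hx.2
  refine ⟨q, ?_, tendsto_measure_forall_iterate_notMem hT.toMeasurePreserving
    (ae_exists_iterate_mem_of_ergodic hT hℓ hGm hq hGinv)
    (tendsto_measure_diff_birkhoffAverage_near hF hGq (half_lt_self hδ))⟩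
  obtain ⟨x, hx : x ∈ G⟩ := nonempty_of_measure_ne_zero hq
  have hle : F j₀ x ≤ ∫ a, F j₀ a ∂ν := hx.1
  linarith [neg_le_of_abs_le (hGq x hx j₀), hFint j₀]

end ErgodicAverages

section BirkhoffSums

variable {α : Type*} {f : α → α} {g : α → ℝ}

theorem birkhoffSum_mem_Icc (hg : ∀ x, g x ∈ Set.Icc 0 1) (n : ℕ) (x : α) :
    birkhoffSum f g n x ∈ Set.Icc 0 (n : ℝ) := by
  refine ⟨Finset.sum_nonneg fun _ _ => (hg _).1, ?_⟩
  simpa only [birkhoffSum, Finset.card_range, nsmul_one] using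
    Finset.sum_le_card_nsmul (Finset.range n) (fun k => g (f^[k] x)) 1 fun _ _ => (hg _).2

theorem birkhoffSum_mul_eq_sum (M ℓ : ℕ) (x : α) :
    birkhoffSum f g (M * ℓ) x = ∑ j ∈ Finset.range M, birkhoffSum f g ℓ (f^[j * ℓ] x) := by
  induction M with
  | zero => simp
  | succ M ih => rw [Nat.succ_mul, birkhoffSum_add, Finset.sum_range_succ, ih]

theorem abs_birkhoffSum_sub_sum_blocks_le (hg : ∀ x, g x ∈ Set.Icc 0 1) (i M ℓ r : ℕ) (x : α) :
    |birkhoffSum f g (i + M * ℓ + r) x -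
      ∑ j ∈ Finset.range M, birkhoffSum f g ℓ (f^[i + j * ℓ] x)| ≤ i + r := by
  have blocks : ∑ j ∈ Finset.range M, birkhoffSum f g ℓ (f^[i + j * ℓ] x) =
      birkhoffSum f g (M * ℓ) (f^[i] x) := by
    simp only [birkhoffSum_mul_eq_sum, ← Function.iterate_add_apply, add_comm]
  have head := birkhoffSum_mem_Icc (f := f) hg i x
  have tail := birkhoffSum_mem_Icc (f := f) hg r (f^[i + M * ℓ] x)
  rw [blocks, birkhoffSum_add, birkhoffSum_add, abs_of_nonneg] <;>
    linarith [head.1, head.2, tail.1, tail.2]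

theorem mul_birkhoffAverage_iterate (ℓ i M : ℕ) (x : α) :
    (M : ℝ) * birkhoffAverage ℝ f^[ℓ] g M (f^[i] x) =
      ∑ j ∈ Finset.range M, g (f^[i + j * ℓ] x) := by
  rcases Nat.eq_zero_or_pos M with rfl | hM
  · simp
  rw [birkhoffAverage, smul_eq_mul, mul_inv_cancel_left₀ (Nat.cast_ne_zero.2 hM.ne'), birkhoffSum]
  simp only [← Function.iterate_mul, ← Function.iterate_add_apply, add_comm, mul_comm]

theorem measurable_birkhoffSum [MeasurableSpace α] (hf : Measurable f) (hg : Measurable g)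
    (n : ℕ) : Measurable (birkhoffSum f g n) :=
  Finset.measurable_sum _ fun k _ => hg.comp (hf.iterate k)

end BirkhoffSums

section Words

variable {K : Finset ℂ}

theorem shift_iterate_apply (n m : ℕ) (x : FullShift K) : (shift K)^[n] x m = x (n + m) := by
  induction n generalizing x with
  | zero => rw [Function.iterate_zero_apply, Nat.zero_add]
  | succ n ih => rw [Function.iterate_succ_apply, ih, shift, Nat.succ_add]

theorem continuous_shift : Continuous (shift K) :=
  continuous_pi fun n => continuous_apply (n + 1)

theorem measurable_shift : Measurable (shift K) :=
  measurable_pi_lambda _ fun n => measurable_pi_apply (n + 1)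

/-- Finite words over the alphabet `K`, bundled with their lengths. -/
abbrev Word (K : Finset ℂ) : Type := Σ m : ℕ, Fin m → K

/-- The cylinder of all sequences that start with the word `v`. -/
def wordCylinder (v : Word K) : Set (FullShift K) := {z | ∀ i : Fin v.1, z i = v.2 i}

/-- The number of occurrences of the word `v` in `z` starting at one of the first `b` positions. -/
noncomputable def occ (v : Word K) (b : ℕ) (z : FullShift K) : ℝ :=
  birkhoffSum (shift K) ((wordCylinder v).indicator 1) b z

/-- The indicator function of the pairs of sequences with different first symbols. -/
noncomputable def mismatchInd : FullShift K × FullShift K → ℝ := {p | p.1 0 ≠ p.2 0}.indicator 1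

/-- The unnormalized Hamming distance of the initial words of length `b` of `x` and `y`. -/
noncomputable def mismatch (b : ℕ) (x y : FullShift K) : ℝ :=
  birkhoffSum (Prod.map (shift K) (shift K)) mismatchInd b (x, y)

theorem indicator_one_mem_Icc {α : Type*} (S : Set α) (x : α) :
    S.indicator (1 : α → ℝ) x ∈ Set.Icc 0 1 :=
  ⟨Set.indicator_nonneg (fun _ _ => zero_le_one) x,
    Set.indicator_le_self' (fun _ _ => zero_le_one) x⟩

theorem isClopen_wordCylinder (v : Word K) : IsClopen (wordCylinder v) := by
  rw [wordCylinder, Set.ofPred_forall]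
  exact isClopen_iInter_of_finite fun i => (isClopen_discrete {v.2 i}).preimage (continuous_apply _)

theorem continuous_indicator_wordCylinder (v : Word K) :
    Continuous ((wordCylinder v).indicator (1 : FullShift K → ℝ)) :=
  continuous_one.indicator fun x hx => by
    rw [(isClopen_wordCylinder v).frontier_eq] at hx
    exact hx.elim

theorem continuous_occ (v : Word K) (b : ℕ) : Continuous (occ v b) :=
  continuous_finsetSum (Finset.range b) fun k _ =>
    (continuous_indicator_wordCylinder v).comp (continuous_shift.iterate k)

theorem occ_mem_Icc (v : Word K) (b : ℕ) (z : FullShift K) : occ v b z ∈ Set.Icc 0 (b : ℝ) :=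
  birkhoffSum_mem_Icc (indicator_one_mem_Icc _) b z

theorem occ_add (v : Word K) (a b : ℕ) (z : FullShift K) :
    occ v (a + b) z = occ v a z + occ v b ((shift K)^[a] z) :=
  birkhoffSum_add _ _ _ _ _

theorem occ_congr {v : Word K} {b : ℕ} {z z' : FullShift K} (h : ∀ m < b + v.1, z m = z' m) :
    occ v b z = occ v b z' := by
  rw [occ, occ, birkhoffSum, birkhoffSum]
  refine Finset.sum_congr rfl fun t ht => Set.indicator_eq_indicator ?_ rfl
  have ht := Finset.mem_range.1 ht
  simp only [wordCylinder, Set.mem_ofPred_eq, shift_iterate_apply]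
  exact forall_congr' fun i => by rw [h (t + i) (by omega)]

theorem abs_occ_sub_le {v : Word K} {b : ℕ} {z z' : FullShift K} (h : ∀ m < b, z m = z' m) :
    |occ v b z - occ v b z'| ≤ v.1 := by
  rcases le_total b v.1 with hb | hb
  · refine (Real.dist_le_of_mem_Icc (occ_mem_Icc v b z) (occ_mem_Icc v b z')).trans ?_
    rw [sub_zero]
    exact_mod_cast hb
  · obtain ⟨c, rfl⟩ := Nat.exists_eq_add_of_le' hb
    rw [occ_add, occ_add, occ_congr h, add_sub_add_left_eq_sub]
    exact (Real.dist_le_of_mem_Icc (occ_mem_Icc v _ _) (occ_mem_Icc v _ _)).trans_eq (sub_zero _)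

theorem mismatchInd_mem_Icc (p : FullShift K × FullShift K) : mismatchInd p ∈ Set.Icc 0 1 :=
  indicator_one_mem_Icc _ p

theorem measurable_mismatchInd : Measurable (mismatchInd (K := K)) :=
  measurable_one.indicator (measurableSet_eq_fun ((measurable_pi_apply 0).comp measurable_fst)
    ((measurable_pi_apply 0).comp measurable_snd)).compl

theorem mismatch_mem_Icc (b : ℕ) (x y : FullShift K) : mismatch b x y ∈ Set.Icc 0 (b : ℝ) :=
  birkhoffSum_mem_Icc mismatchInd_mem_Icc b _

theorem measurable_mismatch (b : ℕ) :
    Measurable fun p : FullShift K × FullShift K => mismatch b p.1 p.2 :=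
  measurable_birkhoffSum (measurable_shift.prodMap measurable_shift) measurable_mismatchInd b

theorem mismatch_eq_sum (b : ℕ) (x y : FullShift K) :
    mismatch b x y = ∑ t ∈ Finset.range b, mismatchInd ((shift K)^[t] x, (shift K)^[t] y) := by
  simp only [mismatch, birkhoffSum, Prod.map_iterate, Prod.map]

theorem mismatch_congr_right {b : ℕ} {x y y' : FullShift K} (h : ∀ m < b, y m = y' m) :
    mismatch b x y = mismatch b x y' := by
  rw [mismatch_eq_sum, mismatch_eq_sum]
  refine Finset.sum_congr rfl fun t ht => Set.indicator_eq_indicator ?_ rfl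
  simp only [Set.mem_ofPred_eq, shift_iterate_apply, add_zero, h t (Finset.mem_range.1 ht)]

end Words

/-- A block code: it assigns to a sequence `x` and a length `b ≥ len` a code word of length `b`,
namely the first `b` symbols of `code b x`; the remaining symbols, and all lengths below `len`, are
irrelevant. The code word of `x` is meant to be close to the first `b` symbols of `x`. -/
structure BlockCode (K : Finset ℂ) where
  len : ℕ
  len_pos : 0 < len
  code : ℕ → FullShift K → FullShift K
  measurable_code : ∀ b, Measurable (code b)

namespace BlockCode

variable {K : Finset ℂ} (s : BlockCode K)

/-- `s.IsBlock z a c`: the word at the positions `a, …, c - 1` of `z` is a code word of `s` of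
length between `s.len` and `3 * s.len`. -/
def IsBlock (z : FullShift K) (a c : ℕ) : Prop :=
  ∃ b x, s.len ≤ b ∧ b ≤ 3 * s.len ∧ c = a + b ∧ ∀ m < b, z (a + m) = s.code b x m

/-- The block code `s'` refines `s` if its code words are concatenations of code words of `s`. -/
def Refines (s' s : BlockCode K) : Prop :=
  ∀ z a c, s'.IsBlock z a c → Relation.ReflTransGen (s.IsBlock z) a c

/-- All code words of `s` have nearly the same frequency of occurrences of the word `v`, namely
`p` up to an error `D`. -/
def HasFrequency (v : Word K) (p D : ℝ) : Prop :=
  ∀ b x, s.len ≤ b → |occ v b (s.code b x) - p * b| ≤ D * b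

/-- The expected fraction of symbols changed by the code words of length `s.len`. -/
noncomputable def err (ν : Measure (FullShift K)) : ℝ :=
  (∫ x, mismatch s.len x (s.code s.len x) ∂ν) / s.len

/-- The number of code words of length exactly `s.len` used in a concatenation of total length `b`.
For `3 * s.len ≤ b` it leaves between three and four times `s.len` for the first and the last
word. -/
def fullBlocks (b : ℕ) : ℕ := b / s.len - 3

/-- A recoding of the first `b` symbols of `x` by code words of `s`: the first word has length `i`
(the phase), it is followed by `s.fullBlocks b` words of length `s.len`, and the last word fills up
the length `b`. -/
def concat (b i : ℕ) (x : FullShift K) : FullShift K := fun m =>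
  if m < i then s.code i x m
  else if m < i + s.fullBlocks b * s.len then
    s.code s.len ((shift K)^[i + (m - i) / s.len * s.len] x) ((m - i) % s.len)
  else s.code (b - (i + s.fullBlocks b * s.len)) ((shift K)^[i + s.fullBlocks b * s.len] x)
    (m - (i + s.fullBlocks b * s.len))

/-- The sum of `g` over the starting positions of the words of length `s.len` in
`s.concat b i x`. -/
noncomputable def phaseSum (g : FullShift K → ℝ) (b i : ℕ) (x : FullShift K) : ℝ :=
  ∑ j ∈ Finset.range (s.fullBlocks b), g ((shift K)^[i + j * s.len] x)

theorem exists_last_length {b i : ℕ} (hb : 3 * s.len ≤ b)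
    (hi : i ∈ Finset.Ico s.len (2 * s.len)) :
    ∃ r, s.len ≤ r ∧ r ≤ 3 * s.len ∧ b = i + s.fullBlocks b * s.len + r ∧ i + r ≤ 4 * s.len := by
  have hi := Finset.mem_Ico.1 hi
  have h3 : 3 ≤ b / s.len := (Nat.le_div_iff_mul_le s.len_pos).2 hb
  have hdiv := Nat.div_add_mod' b s.len
  have hmod := Nat.mod_lt b s.len_pos
  have hfull : s.fullBlocks b * s.len + 3 * s.len = b / s.len * s.len := by
    rw [fullBlocks, ← Nat.add_mul, Nat.sub_add_cancel h3]
  exact ⟨3 * s.len + b % s.len - i, by omega, by omega, by omega, by omega⟩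

theorem measurable_concat (b i : ℕ) : Measurable (s.concat b i) := by
  refine measurable_pi_iff.2 fun m => ?_
  have measurable_symbol (b' n m' : ℕ) : Measurable fun x => s.code b' ((shift K)^[n] x) m' :=
    (measurable_pi_apply m').comp ((s.measurable_code b').comp (measurable_shift.iterate n))
  unfold concat
  split_ifs
  · exact measurable_symbol i 0 m
  · exact measurable_symbol _ _ _
  · exact measurable_symbol _ _ _

theorem concat_first {b i m : ℕ} (x : FullShift K) (h : m < i) :
    s.concat b i x m = s.code i x m := by
  rw [concat, if_pos h]

theorem concat_full {b i j m : ℕ} (x : FullShift K) (hj : j < s.fullBlocks b) (hm : m < s.len) :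
    s.concat b i x (i + j * s.len + m) = s.code s.len ((shift K)^[i + j * s.len] x) m := by
  have hjM : (j + 1) * s.len ≤ s.fullBlocks b * s.len := Nat.mul_le_mul_right _ hj
  rw [Nat.succ_mul] at hjM
  have hsub : i + j * s.len + m - i = m + s.len * j := by rw [mul_comm s.len]; omega
  have hdiv : (m + s.len * j) / s.len = j := by
    rw [Nat.add_mul_div_left _ _ s.len_pos, Nat.div_eq_of_lt hm, zero_add]
  have hmod : (m + s.len * j) % s.len = m := by
    rw [Nat.add_mul_mod_self_left, Nat.mod_eq_of_lt hm]
  rw [concat, if_neg (by omega), if_pos (by omega), hsub, hdiv, hmod]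

theorem concat_last {b i r m : ℕ} (x : FullShift K) (hb : b = i + s.fullBlocks b * s.len + r) :
    s.concat b i x (i + s.fullBlocks b * s.len + m) =
      s.code r ((shift K)^[i + s.fullBlocks b * s.len] x) m := by
  rw [concat, if_neg (by omega), if_neg (by omega), Nat.add_sub_cancel_left,
    show b - (i + s.fullBlocks b * s.len) = r by omega]

theorem reflTransGen_isBlock_of_eq_concat {b i a : ℕ} {x z : FullShift K} (hb : 3 * s.len ≤ b)
    (hi : i ∈ Finset.Ico s.len (2 * s.len)) (hz : ∀ m < b, z (a + m) = s.concat b i x m) :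
    Relation.ReflTransGen (s.IsBlock z) a (a + b) := by
  obtain ⟨r, hr, hr3, hbr, -⟩ := s.exists_last_length hb hi
  have hi := Finset.mem_Ico.1 hi
  have chain : ∀ j ≤ s.fullBlocks b,
      Relation.ReflTransGen (s.IsBlock z) a (a + (i + j * s.len)) := by
    intro j hj
    induction j with
    | zero =>
      refine .single ⟨i, x, hi.1, by omega, by omega, fun m hm => ?_⟩
      rw [hz m (by omega), s.concat_first _ hm]
    | succ j ih =>
      have hjM : (j + 1) * s.len ≤ s.fullBlocks b * s.len := Nat.mul_le_mul_right _ hj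
      rw [Nat.succ_mul] at hjM ⊢
      refine (ih (by omega)).tail ⟨s.len, (shift K)^[i + j * s.len] x, le_rfl, by omega,
        by omega, fun m hm => ?_⟩
      rw [add_assoc, hz _ (by omega), s.concat_full _ (by omega) hm]
  refine (chain _ le_rfl).tail
    ⟨r, (shift K)^[i + s.fullBlocks b * s.len] x, hr, hr3, by omega, fun m hm => ?_⟩
  rw [add_assoc, hz _ (by omega), s.concat_last x hbr]

theorem abs_occ_concat_sub_le {b i r : ℕ} (x : FullShift K)
    (hb : b = i + s.fullBlocks b * s.len + r) (v : Word K) :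
    |occ v b (s.concat b i x) - s.phaseSum (fun y => occ v s.len (s.code s.len y)) b i x| ≤
      s.fullBlocks b * v.1 + (i + r) := by
  have blocks := abs_birkhoffSum_sub_sum_blocks_le (f := shift K)
    (indicator_one_mem_Icc (wordCylinder v)) i (s.fullBlocks b) s.len r (s.concat b i x)
  rw [← hb] at blocks
  have boundary : |∑ j ∈ Finset.range (s.fullBlocks b),
        occ v s.len ((shift K)^[i + j * s.len] (s.concat b i x)) -
      s.phaseSum (fun y => occ v s.len (s.code s.len y)) b i x| ≤ s.fullBlocks b * v.1 := by
    rw [phaseSum, ← Finset.sum_sub_distrib]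
    refine (Finset.abs_sum_le_sum_abs _ _).trans ((Finset.sum_le_card_nsmul _ _ (v.1 : ℝ)
      fun j hj => abs_occ_sub_le fun m hm => ?_).trans_eq
        (by rw [Finset.card_range, nsmul_eq_mul]))
    rw [shift_iterate_apply, s.concat_full _ (Finset.mem_range.1 hj) hm]
  refine (abs_sub_le _ _ _).trans ((add_le_add blocks boundary).trans_eq (add_comm _ _))

theorem mismatch_concat_le {b i r : ℕ} (x : FullShift K)
    (hb : b = i + s.fullBlocks b * s.len + r) :
    mismatch b x (s.concat b i x) ≤
      s.phaseSum (fun y => mismatch s.len y (s.code s.len y)) b i x + (i + r) := by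
  have blocks := le_of_abs_le (abs_birkhoffSum_sub_sum_blocks_le
    (f := Prod.map (shift K) (shift K)) mismatchInd_mem_Icc i (s.fullBlocks b) s.len r
    (x, s.concat b i x))
  rw [← hb, sub_le_iff_le_add'] at blocks
  refine blocks.trans_eq (congrArg (· + ((i : ℝ) + r)) (Finset.sum_congr rfl fun j hj => ?_))
  rw [Prod.map_iterate, Prod.map]
  refine mismatch_congr_right fun m hm => ?_
  rw [shift_iterate_apply, s.concat_full _ (Finset.mem_range.1 hj) hm]

/-- The code words of `s'` are concatenations of code words of `s`, with phases `i` such that the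
recoded point lies in `G b i`; a point that lies in `G b i` for some phase is not replaced by
another point. -/
def IsConcatenation (s' s : BlockCode K) (G : ℕ → ℕ → Set (FullShift K)) : Prop :=
  ∀ b x, s'.len ≤ b →
    ∃ i y, y ∈ G b i ∧ s'.code b x = s.concat b i y ∧ ((∃ k, x ∈ G b k) → y = x)

theorem exists_measurable_concat {b : ℕ} {G : ℕ → Set (FullShift K)}
    (hG : ∀ i, MeasurableSet (G i)) (hne : ∃ i, (G i).Nonempty) :
    ∃ E : FullShift K → FullShift K, Measurable E ∧
      ∀ x, ∃ i y, y ∈ G i ∧ E x = s.concat b i y ∧ ((∃ k, x ∈ G k) → y = x) := by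
  classical
  obtain ⟨i₀, y₀, h₀⟩ := hne
  let typical : FullShift K → FullShift K := fun x => if ∃ i, x ∈ G i then x else y₀
  have measurable_typical : Measurable typical := by
    refine Measurable.ite ?_ measurable_id measurable_const
    rw [Set.ofPred_exists]
    exact MeasurableSet.iUnion hG
  have exists_phase (x : FullShift K) : ∃ i, typical x ∈ G i := by
    by_cases h : ∃ i, x ∈ G i
    · simpa only [typical, if_pos h] using h
    · exact ⟨i₀, by simpa only [typical, if_neg h] using h₀⟩
  have measurable_uncurry : Measurable fun q : ℕ × FullShift K => s.concat b q.1 q.2 :=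
    measurable_from_prod_countable_right fun i => s.measurable_concat b i
  refine ⟨fun x => s.concat b (Nat.find (exists_phase x)) (typical x),
    measurable_uncurry.comp ((measurable_find exists_phase fun i =>
      measurable_typical (hG i)).prodMk measurable_typical), fun x =>
    ⟨_, typical x, Nat.find_spec (exists_phase x), rfl, fun h => if_pos h⟩⟩

theorem exists_isConcatenation {G : ℕ → ℕ → Set (FullShift K)}
    (hG : ∀ b i, MeasurableSet (G b i)) {L : ℕ} (hL : 0 < L)
    (hne : ∀ b, L ≤ b → ∃ i, (G b i).Nonempty) :
    ∃ s' : BlockCode K, s'.len = L ∧ s'.IsConcatenation s G := by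
  have : Nonempty (FullShift K → FullShift K) := ⟨id⟩
  choose! E hEm hE using fun b (hb : L ≤ b) =>
    s.exists_measurable_concat (b := b) (hG b) (hne b hb)
  refine ⟨⟨L, hL, fun b => if L ≤ b then E b else id, fun b => ?_⟩, rfl, fun b x hb => ?_⟩
  · split_ifs with hb
    · exact hEm b hb
    · exact measurable_id
  · simpa only [if_pos hb] using hE b hb x

end BlockCode

namespace BlockCode

variable {K : Finset ℂ} (s : BlockCode K) {s' : BlockCode K} {ν : Measure (FullShift K)}
  {ι : Type*} {w : ι → Word K} {p : Option ι → ℝ} {δ : ℝ}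

/-- The quantities controlled in a refinement, for the code word of length `s.len` of a point: the
number of changed symbols (`none`) and the number of occurrences of each word `w j` (`some j`). -/
noncomputable def blockStat (w : ι → Word K) : Option ι → FullShift K → ℝ
  | none => fun x => mismatch s.len x (s.code s.len x)
  | some j => fun x => occ (w j) s.len (s.code s.len x)

/-- The points for which `i` is an admissible phase for a recoding of length `b`: along the code
words of length `s.len` the block statistics have nearly the prescribed frequencies `p`. -/
def goodPhase (w : ι → Word K) (p : Option ι → ℝ) (δ : ℝ) (b i : ℕ) : Set (FullShift K) :=
  {x | i ∈ Finset.Ico s.len (2 * s.len) ∧ ∀ o,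
    |s.phaseSum (s.blockStat w o) b i x - p o * (s.fullBlocks b * s.len)| ≤
      δ * (s.fullBlocks b * s.len)}

theorem blockStat_mem_Icc (w : ι → Word K) (o : Option ι) (x : FullShift K) :
    s.blockStat w o x ∈ Set.Icc 0 (s.len : ℝ) :=
  match o with
  | none => mismatch_mem_Icc _ _ _
  | some _ => occ_mem_Icc _ _ _

theorem measurable_mismatch_code (b : ℕ) : Measurable fun x => mismatch b x (s.code b x) :=
  (measurable_mismatch b).comp (measurable_id.prodMk (s.measurable_code b))

theorem measurable_blockStat (w : ι → Word K) (o : Option ι) : Measurable (s.blockStat w o) :=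
  match o with
  | none => s.measurable_mismatch_code s.len
  | some j => (continuous_occ (w j) s.len).measurable.comp (s.measurable_code _)

theorem measurableSet_goodPhase [Countable ι] (w : ι → Word K) (p : Option ι → ℝ) (δ : ℝ)
    (b i : ℕ) : MeasurableSet (s.goodPhase w p δ b i) := by
  have measurable_phaseSum (o : Option ι) : Measurable (s.phaseSum (s.blockStat w o) b i) :=
    Finset.measurable_sum _ fun j _ =>
      (s.measurable_blockStat w o).comp (measurable_shift.iterate _)
  rw [goodPhase, Set.ofPred_and, Set.ofPred_forall]
  exact (MeasurableSet.const _).inter (MeasurableSet.iInter fun o =>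
    measurableSet_le ((measurable_phaseSum o).sub_const _).norm measurable_const)

theorem err_nonneg (ν : Measure (FullShift K)) : 0 ≤ s.err ν :=
  div_nonneg (integral_nonneg fun _ => (mismatch_mem_Icc _ _ _).1) (Nat.cast_nonneg _)

theorem tendsto_fullBlocks : Tendsto s.fullBlocks atTop atTop :=
  (tendsto_sub_atTop_nat 3).comp (Nat.tendsto_div_const_atTop s.len_pos.ne')

theorem exists_tendsto_measure_notMem_goodPhase [IsProbabilityMeasure ν] [Finite ι]
    (hν : Ergodic (shift K) ν) (w : ι → Word K) (hδ : 0 < δ) :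
    ∃ p : Option ι → ℝ, p none ≤ s.err ν + δ ∧
      Tendsto (fun b => ν {x | ∀ i, x ∉ s.goodPhase w p δ b i}) atTop (𝓝 0) := by
  have hlen : (0 : ℝ) < s.len := Nat.cast_pos.2 s.len_pos
  obtain ⟨q, hq, hlim⟩ := exists_phase_birkhoffAverage hν s.len_pos (f := s.blockStat w)
    (fun o => MemLp.of_bound (s.measurable_blockStat w o).aestronglyMeasurable s.len
      (ae_of_all _ fun x => by
        rw [Real.norm_eq_abs, abs_of_nonneg (s.blockStat_mem_Icc w o x).1]
        exact (s.blockStat_mem_Icc w o x).2)) none (mul_pos hδ hlen)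
  refine ⟨fun o => q o / s.len, ?_, ?_⟩
  · rw [err, div_add' _ _ _ hlen.ne']
    exact div_le_div_of_nonneg_right hq hlen.le
  · refine tendsto_of_tendsto_of_tendsto_of_le_of_le tendsto_const_nhds
      (hlim.comp s.tendsto_fullBlocks) (fun _ => zero_le)
      fun b => measure_mono fun x hx i hi hgood => hx i ⟨hi, fun o => ?_⟩
    have hM : (0 : ℝ) ≤ s.fullBlocks b := Nat.cast_nonneg _
    have scaled := mul_le_mul_of_nonneg_left (hgood o) hM
    rw [← abs_of_nonneg hM, ← abs_mul, abs_of_nonneg hM, mul_sub, mul_birkhoffAverage_iterate]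
      at scaled
    have cancel : q o / s.len * (s.fullBlocks b * s.len) = s.fullBlocks b * q o := by
      rw [mul_left_comm, div_mul_cancel₀ _ hlen.ne']
    rwa [cancel, mul_left_comm]

theorem IsConcatenation.refines {G : ℕ → ℕ → Set (FullShift K)} (h : s'.IsConcatenation s G)
    (hG : ∀ b i x, x ∈ G b i → i ∈ Finset.Ico s.len (2 * s.len)) (hlen : 3 * s.len ≤ s'.len) :
    s'.Refines s := by
  rintro z a c ⟨b, x, hb, -, rfl, hz⟩
  obtain ⟨i, y, hy, hcode, -⟩ := h b x hb
  exact s.reflTransGen_isBlock_of_eq_concat (hlen.trans hb) (hG b i y hy) (hcode ▸ hz)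

variable {s}

theorem abs_le_two_of_mem_goodPhase {b i : ℕ} {y : FullShift K}
    (hy : y ∈ s.goodPhase w p δ b i) (hb : 0 < s.fullBlocks b) (hδ : δ ≤ 1) (o : Option ι) :
    |p o| ≤ 2 := by
  have hpos : (0 : ℝ) < s.fullBlocks b * s.len :=
    mul_pos (Nat.cast_pos.2 hb) (Nat.cast_pos.2 s.len_pos)
  have phaseSum_nonneg : 0 ≤ s.phaseSum (s.blockStat w o) b i y :=
    Finset.sum_nonneg fun _ _ => (s.blockStat_mem_Icc w o _).1
  have phaseSum_le : s.phaseSum (s.blockStat w o) b i y ≤ s.fullBlocks b * s.len :=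
    (Finset.sum_le_card_nsmul _ _ _ fun _ _ => (s.blockStat_mem_Icc w o _).2).trans_eq
      (by rw [Finset.card_range, nsmul_eq_mul])
  obtain ⟨hlow, hupp⟩ := abs_le.1 (hy.2 o)
  rw [abs_le]
  constructor <;> nlinarith

theorem length_bounds {L b : ℕ} (hδ : δ ≤ 1) (hL : 12 * (s.len : ℝ) ≤ δ * L) (hb : L ≤ b) :
    12 * s.len ≤ b ∧ 12 * (s.len : ℝ) ≤ δ * b := by
  have hLb : (L : ℝ) ≤ b := Nat.cast_le.2 hb
  have hlen : (0 : ℝ) < s.len := Nat.cast_pos.2 s.len_pos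
  have hδ0 : 0 ≤ δ := by
    by_contra! hneg
    nlinarith [Nat.cast_nonneg (α := ℝ) L]
  have hδb : 12 * (s.len : ℝ) ≤ δ * b := hL.trans (mul_le_mul_of_nonneg_left hLb hδ0)
  refine ⟨?_, hδb⟩
  exact_mod_cast hδb.trans (mul_le_of_le_one_left (Nat.cast_nonneg b) hδ)

theorem IsConcatenation.hasFrequency (h : s'.IsConcatenation s (s.goodPhase w p δ)) (hδ0 : 0 ≤ δ)
    (hδ1 : δ ≤ 1) (hlen : 12 * (s.len : ℝ) ≤ δ * s'.len) {j : ι}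
    (hw : ((w j).1 : ℝ) ≤ δ * s.len) :
    s'.HasFrequency (w j) (p (some j)) (3 * δ) := by
  intro b x hb
  obtain ⟨i, y, hy, hcode, -⟩ := h b x hb
  obtain ⟨hlenb, hδb⟩ := length_bounds hδ1 hlen hb
  obtain ⟨r, -, -, hbr, hir⟩ := s.exists_last_length (b := b) (by omega) hy.1
  have hbr' : (b : ℝ) = i + s.fullBlocks b * s.len + r := by exact_mod_cast hbr
  have hir' : (i : ℝ) + r ≤ 4 * s.len := by exact_mod_cast hir
  have fullBlocks_pos : 0 < s.fullBlocks b :=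
    Nat.pos_of_ne_zero fun h0 => by
      rw [h0] at hbr
      have := s.len_pos
      omega
  have boundary := s.abs_occ_concat_sub_le y hbr (w j)
  have phase := hy.2 (some j)
  have rest : |p (some j) * (i + r)| ≤ 2 * (i + r) := by
    rw [abs_mul, abs_of_nonneg (a := (i : ℝ) + r) (by positivity)]
    exact mul_le_mul_of_nonneg_right (abs_le_two_of_mem_goodPhase hy fullBlocks_pos hδ1 _)
      (by positivity)
  have word_length := mul_le_mul_of_nonneg_left hw (Nat.cast_nonneg (α := ℝ) (s.fullBlocks b))
  have full_length : δ * (s.fullBlocks b * s.len) ≤ δ * b :=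
    mul_le_mul_of_nonneg_left
      (by linarith [Nat.cast_nonneg (α := ℝ) i, Nat.cast_nonneg (α := ℝ) r]) hδ0
  have hpb : p (some j) * b = p (some j) * (s.fullBlocks b * s.len) + p (some j) * (i + r) := by
    rw [hbr']; ring
  rw [hcode, hpb]
  simp only [blockStat] at phase
  rw [abs_le] at boundary phase rest ⊢
  constructor <;> linarith

theorem IsConcatenation.mismatch_le (h : s'.IsConcatenation s (s.goodPhase w p δ))
    (hp : p none ≤ s.err ν + δ) (hδ0 : 0 ≤ δ) (hδ1 : δ ≤ 1)
    (hlen : 12 * (s.len : ℝ) ≤ δ * s'.len) {x : FullShift K}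
    (hx : ∃ i, x ∈ s.goodPhase w p δ s'.len i) :
    mismatch s'.len x (s'.code s'.len x) ≤ (s.err ν + 5 / 2 * δ) * s'.len := by
  obtain ⟨i, y, hy, hcode, hyx⟩ := h s'.len x le_rfl
  obtain rfl := hyx hx
  obtain ⟨hlenL, -⟩ := length_bounds hδ1 hlen le_rfl
  obtain ⟨r, -, -, hLr, hir⟩ := s.exists_last_length (b := s'.len) (by omega) hy.1
  have hLr' : (s'.len : ℝ) = i + s.fullBlocks s'.len * s.len + r := by exact_mod_cast hLr
  have hir' : (i : ℝ) + r ≤ 4 * s.len := by exact_mod_cast hir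
  have hconcat := s.mismatch_concat_le y hLr
  have phase := (abs_le.1 (hy.2 none)).2
  have full_length : (s.err ν + 2 * δ) * (s.fullBlocks s'.len * s.len) ≤
      (s.err ν + 2 * δ) * s'.len :=
    mul_le_mul_of_nonneg_left
      (by linarith [Nat.cast_nonneg (α := ℝ) i, Nat.cast_nonneg (α := ℝ) r])
      (by linarith [s.err_nonneg ν])
  have frequency_le : p none * (s.fullBlocks s'.len * s.len) ≤
      (s.err ν + δ) * (s.fullBlocks s'.len * s.len) :=
    mul_le_mul_of_nonneg_right hp (by positivity)
  simp only [blockStat] at phase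
  rw [hcode]
  linarith

theorem IsConcatenation.err_le [IsProbabilityMeasure ν] [Countable ι]
    (h : s'.IsConcatenation s (s.goodPhase w p δ)) (hp : p none ≤ s.err ν + δ) (hδ0 : 0 ≤ δ)
    (hδ1 : δ ≤ 1) (hlen : 12 * (s.len : ℝ) ≤ δ * s'.len)
    (hbad : ν.real {x | ∀ i, x ∉ s.goodPhase w p δ s'.len i} ≤ δ / 2) :
    s'.err ν ≤ s.err ν + 3 * δ := by
  set B := {x | ∀ i, x ∉ s.goodPhase w p δ s'.len i}
  have hB : MeasurableSet B := by
    simp only [B, Set.ofPred_forall]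
    exact MeasurableSet.iInter fun i => (s.measurableSet_goodPhase w p δ _ i).compl
  have pointwise (x : FullShift K) : mismatch s'.len x (s'.code s'.len x) ≤
      (s.err ν + 5 / 2 * δ) * s'.len + B.indicator (fun _ => (s'.len : ℝ)) x := by
    by_cases hx : x ∈ B
    · rw [Set.indicator_of_mem hx]
      exact (mismatch_mem_Icc _ _ _).2.trans (le_add_of_nonneg_left
        (mul_nonneg (by linarith [s.err_nonneg ν]) (Nat.cast_nonneg _)))
    · rw [Set.indicator_of_notMem hx, add_zero]
      simp only [B, Set.mem_ofPred_eq, not_forall, not_not] at hx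
      exact h.mismatch_le hp hδ0 hδ1 hlen hx
  rw [err, div_le_iff₀ (Nat.cast_pos.2 s'.len_pos)]
  calc ∫ x, mismatch s'.len x (s'.code s'.len x) ∂ν
      ≤ ∫ x, ((s.err ν + 5 / 2 * δ) * s'.len + B.indicator (fun _ => (s'.len : ℝ)) x) ∂ν :=
        integral_mono (Integrable.of_mem_Icc 0 s'.len
            (s'.measurable_mismatch_code _).aemeasurable
            (ae_of_all _ fun x => mismatch_mem_Icc _ _ _))
          ((integrable_const _).add ((integrable_const _).indicator hB)) pointwise
    _ = (s.err ν + 5 / 2 * δ) * s'.len + ν.real B * s'.len := by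
        rw [integral_add (integrable_const _) ((integrable_const _).indicator hB), integral_const,
          integral_indicator_const _ hB, probReal_univ, one_smul, smul_eq_mul]
    _ ≤ (s.err ν + 3 * δ) * s'.len := by
        linarith [mul_le_mul_of_nonneg_right hbad (Nat.cast_nonneg (α := ℝ) s'.len)]

theorem exists_refinement [IsProbabilityMeasure ν] [Finite ι] (s : BlockCode K)
    (hν : Ergodic (shift K) ν) (hδ0 : 0 < δ) (hδ1 : δ ≤ 1) {w : ι → Word K}
    (hw : ∀ j, ((w j).1 : ℝ) ≤ δ * s.len) (N : ℕ) :
    ∃ s' : BlockCode K, N ≤ s'.len ∧ s'.err ν ≤ s.err ν + 3 * δ ∧ s'.Refines s ∧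
      ∀ j, ∃ p, s'.HasFrequency (w j) p (3 * δ) := by
  obtain ⟨p, hp, hlim⟩ := s.exists_tendsto_measure_notMem_goodPhase hν w hδ0
  have bad_small : ∀ᶠ b in atTop,
      ν {x | ∀ i, x ∉ s.goodPhase w p δ b i} ≤ ENNReal.ofReal (δ / 2) :=
    hlim.eventually_le_const (ENNReal.ofReal_pos.2 (half_pos hδ0))
  obtain ⟨L₀, hL₀⟩ := eventually_atTop.1 bad_small
  obtain ⟨L₁, hL₁⟩ := exists_nat_ge (12 * s.len / δ)
  rw [div_le_iff₀' hδ0] at hL₁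
  obtain ⟨s', hlen, hs'⟩ := s.exists_isConcatenation (L := max N (max L₀ (L₁ + 1)))
    (s.measurableSet_goodPhase w p δ) (by omega) fun b hb => by
      by_contra! hempty
      have hone : ν Set.univ ≤ ENNReal.ofReal (δ / 2) :=
        (measure_mono fun x _ => show ∀ i, x ∉ _ from fun i hx => (hempty i).subset hx).trans
          (hL₀ b (by omega))
      rw [measure_univ, ENNReal.one_le_ofReal] at hone
      linarith
  have hlen' : 12 * (s.len : ℝ) ≤ δ * s'.len :=
    hL₁.trans (mul_le_mul_of_nonneg_left (Nat.cast_le.2 (by omega)) hδ0.le)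
  refine ⟨s', by omega, hs'.err_le hp hδ0.le hδ1 hlen' ?_, hs'.refines s (fun b i x hx => hx.1) ?_,
    fun j => ⟨p (some j), hs'.hasFrequency hδ0.le hδ1 hlen' (hw j)⟩⟩
  · exact ENNReal.toReal_le_of_le_ofReal (half_pos hδ0).le (hL₀ _ (by omega))
  · have := (length_bounds hδ1 hlen' le_rfl).1
    omega

end BlockCode

namespace BlockCode

variable {K : Finset ℂ} {ν : Measure (FullShift K)}

/-- The block code of length `n + 1` that changes nothing. -/
def identity (K : Finset ℂ) (n : ℕ) : BlockCode K where
  len := n + 1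
  len_pos := n.succ_pos
  code _ := id
  measurable_code _ := measurable_id

theorem err_identity (n : ℕ) : (identity K n).err ν = 0 := by
  have mismatch_self (b : ℕ) (x : FullShift K) : mismatch b x x = 0 := by
    simp [mismatch_eq_sum, mismatchInd]
  simp [err, identity, mismatch_self]

/-- A sequence of successive refinements with errors controlled by `δ n`. The code words of
`S (n + 1)` contain each of the words `w 0, …, w (n - 1)` with a nearly constant frequency, which is
given by `p n`. -/
structure IsRefiningSequence (S : ℕ → BlockCode K) (ν : Measure (FullShift K)) (w : ℕ → Word K)
    (δ : ℕ → ℝ) (p : ℕ → ℕ → ℝ) : Prop where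
  le_len : ∀ n, n ≤ (S n).len
  err_le : ∀ n, (S n).err ν ≤ ∑ k ∈ Finset.range n, 3 * δ k
  word_le : ∀ n, ∀ j < n, ((w j).1 : ℝ) ≤ δ n * (S n).len
  refines : ∀ n, (S (n + 1)).Refines (S n)
  hasFrequency : ∀ n, ∀ j < n, (S (n + 1)).HasFrequency (w j) (p n j) (3 * δ n)

theorem exists_isRefiningSequence [IsProbabilityMeasure ν] (hν : Ergodic (shift K) ν)
    (w : ℕ → Word K) {δ : ℕ → ℝ} (hδ0 : ∀ n, 0 < δ n) (hδ1 : ∀ n, δ n ≤ 1) :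
    ∃ S p, IsRefiningSequence S ν w δ p := by
  have exists_length (n : ℕ) : ∃ L : ℕ, n ≤ L ∧ ∀ j < n, ((w j).1 : ℝ) ≤ δ n * L := by
    have word_short (j : ℕ) : ∀ᶠ L : ℕ in atTop, ((w j).1 : ℝ) ≤ δ n * L :=
      (tendsto_natCast_atTop_atTop.const_mul_atTop (hδ0 n)).eventually_ge_atTop _
    exact ((eventually_ge_atTop n).and
      ((Set.finite_lt_nat n).eventually_all.2 fun j _ => word_short j)).exists
  choose L hnL hwL using exists_length
  have word_le (n : ℕ) (s : {s : BlockCode K // L n ≤ s.len}) (j : ℕ) (hj : j < n) :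
      ((w j).1 : ℝ) ≤ δ n * s.1.len :=
    (hwL n j hj).trans (mul_le_mul_of_nonneg_left (Nat.cast_le.2 s.2) (hδ0 n).le)
  have refinement (n : ℕ) (s : {s : BlockCode K // L n ≤ s.len}) :
      ∃ s' : {s : BlockCode K // L (n + 1) ≤ s.len}, s'.1.err ν ≤ s.1.err ν + 3 * δ n ∧
        s'.1.Refines s.1 ∧ ∃ p : ℕ → ℝ, ∀ j < n, s'.1.HasFrequency (w j) (p j) (3 * δ n) := by
    obtain ⟨s', hlen, herr, href, hfreq⟩ := s.1.exists_refinement hν (hδ0 n) (hδ1 n)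
      (w := fun j : Fin n => w j) (fun j => word_le n s j j.2) (L (n + 1))
    choose p hp using hfreq
    exact ⟨⟨s', hlen⟩, herr, href, fun j => if hj : j < n then p ⟨j, hj⟩ else 0,
      fun j hj => by simpa only [dif_pos hj] using hp ⟨j, hj⟩⟩
  choose next hnext_err hnext_refines p hp using refinement
  let S : ∀ n, {s : BlockCode K // L n ≤ s.len} :=
    Nat.rec ⟨identity K (L 0), Nat.le_succ _⟩ next
  have err_le (n : ℕ) : (S n).1.err ν ≤ ∑ k ∈ Finset.range n, 3 * δ k := by
    induction n with
    | zero => exact (err_identity _).le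
    | succ n ih =>
      rw [Finset.sum_range_succ]
      exact (hnext_err n (S n)).trans (add_le_add_left ih _)
  exact ⟨fun n => (S n).1, fun n => p n (S n), fun n => (hnL n).trans (S n).2, err_le,
    fun n => word_le n (S n), fun n => hnext_refines n (S n), fun n => hp n (S n)⟩

end BlockCode

section Chains

variable {r : ℕ → ℕ → Prop} {g : ℕ} {d : ℕ → ℝ} {C D : ℝ}

theorem exists_reflTransGen_cut (hr : ∀ a c, r a c → c ≤ a + g) {x y a : ℕ}
    (h : Relation.ReflTransGen r x y) (hx : x ≤ a) (hy : a ≤ y) :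
    ∃ m ∈ Set.Icc a (a + g), Relation.ReflTransGen r x m ∧ Relation.ReflTransGen r m y := by
  induction h with
  | refl => exact ⟨x, ⟨hy, by omega⟩, .refl, .refl⟩
  | @tail b c hb hbc ih =>
    rcases le_or_gt a b with hab | hab
    · obtain ⟨m, hm, hxm, hmb⟩ := ih hab
      exact ⟨m, hm, hxm, hmb.tail hbc⟩
    · exact ⟨c, ⟨hy, (hr _ _ hbc).trans (by omega)⟩, hb.tail hbc, .refl⟩

theorem abs_sub_le_of_forall_succ (hC : ∀ m, |d (m + 1) - d m| ≤ C) {a c : ℕ} (hac : a ≤ c) :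
    |d c - d a| ≤ C * ((c : ℝ) - a) := by
  have h := dist_le_Ico_sum_of_dist_le (f := d) hac (d := fun _ => C) fun {k} _ _ =>
    (dist_comm _ _).trans_le (hC k)
  rwa [dist_comm, Real.dist_eq, Finset.sum_const, Nat.card_Ico, nsmul_eq_mul, Nat.cast_sub hac,
    mul_comm] at h

theorem abs_sub_le_of_reflTransGen (hd : ∀ a c, r a c → |d c - d a| ≤ D * ((c : ℝ) - a))
    {x y : ℕ} (h : Relation.ReflTransGen r x y) : |d y - d x| ≤ D * ((y : ℝ) - x) := by
  induction h with
  | refl => simp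
  | @tail b c _ hbc ih => linarith [abs_sub_le (d c) (d b) (d x), hd _ _ hbc]

/-- The interval is compared with the part of the chain between the first points of the chain
after its endpoints. -/
theorem abs_sub_le_of_unbounded_chain (hr : ∀ a c, r a c → c ≤ a + g) (hD : 0 ≤ D)
    (hC : ∀ m, |d (m + 1) - d m| ≤ C) (hd : ∀ a c, r a c → |d c - d a| ≤ D * ((c : ℝ) - a))
    (hun : ∀ m, ∃ T, m ≤ T ∧ Relation.ReflTransGen r 0 T) (a b : ℕ) :
    |d (a + b) - d a| ≤ D * b + (D + 2 * C) * g := by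
  have hC0 : 0 ≤ C := (abs_nonneg _).trans (hC 0)
  obtain ⟨T, hT, h0T⟩ := hun (a + b)
  have near (a' m : ℕ) (hm : m ∈ Set.Icc a' (a' + g)) : |d m - d a'| ≤ C * g := by
    have : (m : ℝ) ≤ a' + g := by exact_mod_cast hm.2
    exact (abs_sub_le_of_forall_succ hC hm.1).trans
      (mul_le_mul_of_nonneg_left (by linarith) hC0)
  obtain ⟨m₁, hm₁, -, hm₁T⟩ := exists_reflTransGen_cut hr h0T (Nat.zero_le a) (by omega)
  rcases le_total m₁ (a + b) with hle | hle
  · obtain ⟨m₂, hm₂, hm₁m₂, -⟩ := exists_reflTransGen_cut hr hm₁T hle hT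
    have chain_length : (m₂ : ℝ) - m₁ ≤ b + g := by
      have : (m₂ : ℝ) ≤ a + b + g := by exact_mod_cast hm₂.2
      have : (a : ℝ) ≤ m₁ := by exact_mod_cast hm₁.1
      linarith
    have chain := (abs_sub_le_of_reflTransGen hd hm₁m₂).trans
      (mul_le_mul_of_nonneg_left chain_length hD)
    have start := near a m₁ hm₁
    have finish := near (a + b) m₂ hm₂
    rw [abs_le] at *
    constructor <;> linarith
  · have direct := near a (a + b) ⟨by omega, hle.trans hm₁.2⟩
    have : 0 ≤ D * b := by positivity
    have : 0 ≤ D * g := by positivity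
    have : 0 ≤ C * g := by positivity
    linarith

end Chains

namespace BlockCode

variable {K : Finset ℂ} {s s' : BlockCode K} {S : ℕ → BlockCode K} {ν : Measure (FullShift K)}

/-- `z` is an infinite concatenation of code words of `s`. -/
def IsCoded (s : BlockCode K) (z : FullShift K) : Prop :=
  ∀ m, ∃ T, m ≤ T ∧ Relation.ReflTransGen (s.IsBlock z) 0 T

theorem Refines.isCoded (h : s'.Refines s) {z : FullShift K} (hz : s'.IsCoded z) : s.IsCoded z :=
  fun m => (hz m).imp fun _ hT => ⟨hT.1, Relation.reflTransGen_closed (h z) _ _ hT.2⟩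

theorem isCoded_of_le (hS : ∀ n, (S (n + 1)).Refines (S n)) {k n : ℕ} (hkn : k ≤ n)
    {z : FullShift K} (hz : (S n).IsCoded z) : (S k).IsCoded z := by
  induction n, hkn using Nat.le_induction with
  | base => exact hz
  | succ n _ ih => exact ih ((hS n).isCoded hz)

theorem HasFrequency.abs_occ_sub_le {v : Word K} {p D δ : ℝ} (hs : s.HasFrequency v p D)
    (hD : 0 ≤ D) (hδ : 0 ≤ δ) (hv : (v.1 : ℝ) ≤ δ * s.len) {z : FullShift K} (hz : s.IsCoded z)
    (a b : ℕ) :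
    |occ v b ((shift K)^[a] z) - p * b| ≤
      (D + δ) * b + (D + δ + 2 * (1 + |p|)) * (3 * s.len : ℕ) := by
  have increment (a b : ℕ) : occ v (a + b) z - p * (a + b : ℕ) - (occ v a z - p * a) =
      occ v b ((shift K)^[a] z) - p * b := by
    rw [occ_add, Nat.cast_add]
    ring
  rw [← increment]
  refine abs_sub_le_of_unbounded_chain (r := s.IsBlock z) (d := fun m => occ v m z - p * m)
    ?_ (add_nonneg hD hδ) (fun m => ?_) ?_ hz a b
  · rintro a c ⟨b, x, -, hb, rfl, -⟩
    omega
  · have symbol := occ_mem_Icc v 1 ((shift K)^[m] z)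
    rw [increment, Nat.cast_one, mul_one]
    rw [Nat.cast_one] at symbol
    exact (abs_sub _ _).trans (add_le_add_left (abs_le.2 ⟨by linarith [symbol.1], symbol.2⟩) _)
  · rintro a _ ⟨b, x, hb, -, rfl, hcode⟩
    have frequency := hs b x hb
    have boundary : |occ v b ((shift K)^[a] z) - occ v b (s.code b x)| ≤ v.1 :=
      _root_.abs_occ_sub_le fun m hm => by rw [shift_iterate_apply, hcode m hm]
    have hδb : δ * s.len ≤ δ * b := mul_le_mul_of_nonneg_left (Nat.cast_le.2 hb) hδ
    rw [increment, Nat.cast_add, add_sub_cancel_left]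
    linarith [abs_sub_le (occ v b ((shift K)^[a] z)) (occ v b (s.code b x)) (p * b)]

variable (s)

/-- The periodic sequence that repeats the code word of `x` of length `s.len`. -/
def periodicCode (x : FullShift K) : FullShift K := fun m => s.code s.len x (m % s.len)

theorem measurable_periodicCode : Measurable s.periodicCode :=
  measurable_pi_iff.2 fun _ => (measurable_pi_apply _).comp (s.measurable_code _)

theorem isCoded_periodicCode (x : FullShift K) : s.IsCoded (s.periodicCode x) := by
  refine fun m => ⟨m * s.len, Nat.le_mul_of_pos_right _ s.len_pos, ?_⟩
  induction m with
  | zero => rw [Nat.zero_mul]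
  | succ m ih =>
    refine ih.tail ⟨s.len, x, le_rfl, by omega, Nat.succ_mul _ _, fun t ht => ?_⟩
    rw [periodicCode, Nat.mul_add_mod_self_right, Nat.mod_eq_of_lt ht]

theorem integral_mismatch_periodicCode (ν : Measure (FullShift K)) :
    ∫ x, mismatch s.len x (s.periodicCode x) ∂ν = s.err ν * s.len := by
  rw [err, div_mul_cancel₀ _ (Nat.cast_ne_zero.2 s.len_pos.ne')]
  refine integral_congr_ae (ae_of_all _ fun x => mismatch_congr_right fun m hm => ?_)
  rw [periodicCode, Nat.mod_eq_of_lt hm]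

end BlockCode

section UniformFrequencies

variable {K : Finset ℂ} {ι : Type*}

/-- The sequences in which the word `w j` occurs with frequency `p j` up to an error `η`, uniformly
in the sense that the initial words of all lengths satisfy this up to a constant `R j`. -/
def frequencySet (w : ι → Word K) (p R : ι → ℝ) (η : ℝ) : Set (FullShift K) :=
  {z | ∀ j b, |occ (w j) b z - p j * b| ≤ η * b + R j}

theorem isClosed_frequencySet (w : ι → Word K) (p R : ι → ℝ) (η : ℝ) :
    IsClosed (frequencySet w p R η) := by
  simp only [frequencySet, Set.ofPred_forall]
  exact isClosed_iInter fun j => isClosed_iInter fun b =>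
    isClosed_le ((continuous_occ (w j) b).sub continuous_const).abs continuous_const

theorem integral_birkhoffSum {α : Type*} [MeasurableSpace α] {f : α → α} {ρ : Measure α}
    (hf : MeasurePreserving f ρ ρ) {g : α → ℝ} (hg : Integrable g ρ) (n : ℕ) :
    ∫ x, birkhoffSum f g n x ∂ρ = n * ∫ x, g x ∂ρ := by
  have integral_iterate (k : ℕ) : ∫ x, g (f^[k] x) ∂ρ = ∫ x, g x ∂ρ := by
    have hk := hf.iterate k
    rw [← integral_map hk.aemeasurable (hk.map_eq.symm ▸ hg.aestronglyMeasurable), hk.map_eq]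
  simp only [birkhoffSum]
  rw [integral_finsetSum (f := fun k x => g (f^[k] x)) _ fun k _ =>
    (hf.iterate k).integrable_comp_of_integrable hg]
  simp only [integral_iterate, Finset.sum_const, Finset.card_range, nsmul_eq_mul]

theorem abs_measureReal_wordCylinder_sub_le {w : ι → Word K} {p R : ι → ℝ} {η : ℝ}
    {ρ : Measure (FullShift K)} (hρ : IsShiftInvariant ρ) (hX : ρ (frequencySet w p R η)ᶜ = 0)
    (j : ι) : |ρ.real (wordCylinder (w j)) - p j| ≤ η := by
  have := hρ.isProbabilityMeasure
  have hmeas : MeasurableSet (wordCylinder (w j)) := (isClopen_wordCylinder _).isOpen.measurableSet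
  have linear (b : ℕ) : |ρ.real (wordCylinder (w j)) - p j| * b ≤ η * b + R j := by
    have integral_eq : ∫ z, (occ (w j) b z - p j * b) ∂ρ =
        (ρ.real (wordCylinder (w j)) - p j) * b := by
      rw [integral_sub ((continuous_occ _ _).integrable_of_hasCompactSupport (.of_compactSpace _))
        (integrable_const _), integral_const, probReal_univ, one_smul]
      simp only [occ]
      rw [integral_birkhoffSum hρ.measurePreserving (g := (wordCylinder (w j)).indicator 1)
        ((integrable_const _).indicator hmeas)]
      simp only [integral_indicator_one hmeas]
      ring
    rw [← Nat.abs_cast b, ← abs_mul, Nat.abs_cast, ← integral_eq]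
    have mem_frequencySet : ∀ᵐ z ∂ρ, z ∈ frequencySet w p R η := mem_ae_iff.2 hX
    simpa only [probReal_univ, mul_one, Real.norm_eq_abs] using
      norm_integral_le_of_norm_le_const (f := fun z => occ (w j) b z - p j * b)
        (mem_frequencySet.mono fun z hz => hz j b)
  by_contra! hlt
  obtain ⟨b, hb⟩ := exists_nat_gt (R j / (|ρ.real (wordCylinder (w j)) - p j| - η))
  rw [div_lt_iff₀ (sub_pos.2 hlt)] at hb
  linarith [linear b]

theorem measure_ext_of_wordCylinder {ρ ρ' : Measure (FullShift K)} [IsFiniteMeasure ρ]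
    [IsFiniteMeasure ρ'] (h : ∀ v, ρ (wordCylinder v) = ρ' (wordCylinder v)) : ρ = ρ' := by
  refine IsProjectiveLimit.unique (P := fun I : Finset ℕ => ρ.map I.restrict) (fun I => rfl)
    fun I => ?_
  obtain ⟨m, hm⟩ : ∃ m, I ⊆ Finset.range m := I.exists_nat_subset_range
  have hrange : ρ'.map (Finset.range m).restrict = ρ.map (Finset.range m).restrict := by
    refine Measure.ext_of_singleton fun u => ?_
    have hpre : (Finset.range m).restrict (π := fun _ => K) ⁻¹' {u} =
        wordCylinder ⟨m, fun i => u ⟨i, Finset.mem_range.2 i.2⟩⟩ := by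
      ext z
      simp only [Set.mem_preimage, Set.mem_singleton_iff, funext_iff, wordCylinder,
        Set.mem_ofPred_eq, Subtype.forall, Fin.forall_iff, Finset.mem_range, Finset.restrict]
    rw [Measure.map_apply (by fun_prop) (measurableSet_singleton _),
      Measure.map_apply (by fun_prop) (measurableSet_singleton _), hpre, h]
  have hcomp : (I.restrict : FullShift K → _) =
      Finset.restrict₂ hm ∘ (Finset.range m).restrict := rfl
  simp only [hcomp]
  rw [← Measure.map_map (by fun_prop) (by fun_prop), hrange,
    Measure.map_map (by fun_prop) (by fun_prop)]

theorem subsingleton_invariant_of_frequencySet {w : ℕ → Word K} (hw : Function.Surjective w)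
    {η : ℕ → ℝ} (hη : Tendsto η atTop (𝓝 0)) (p R : ∀ k, Fin k → ℝ) :
    {ρ | IsShiftInvariant ρ ∧ ρ (⋂ k, frequencySet (fun j : Fin k => w j) (p k) (R k) (η k))ᶜ = 0}
      |>.Subsingleton := by
  rintro ρ ⟨hρ, hX⟩ ρ' ⟨hρ', hX'⟩
  have := hρ.isProbabilityMeasure
  have := hρ'.isProbabilityMeasure
  refine measure_ext_of_wordCylinder fun v => ?_
  obtain ⟨j, rfl⟩ := hw v
  rw [Set.compl_iInter, measure_iUnion_null_iff] at hX hX'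
  have close : ∀ᶠ k in atTop,
      |ρ.real (wordCylinder (w j)) - ρ'.real (wordCylinder (w j))| ≤ η k + η k := by
    filter_upwards [eventually_gt_atTop j] with k hk
    have hp := abs_measureReal_wordCylinder_sub_le hρ (hX k) ⟨j, hk⟩
    have hp' := abs_measureReal_wordCylinder_sub_le hρ' (hX' k) ⟨j, hk⟩
    rw [abs_sub_comm] at hp'
    exact (abs_sub_le _ _ _).trans (add_le_add hp hp')
  have hzero := ge_of_tendsto (by simpa only [add_zero] using hη.add hη) close
  exact (measureReal_eq_measureReal_iff).1 (sub_eq_zero.1 (abs_nonpos_iff.1 hzero))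

/-- The points `Φ n x` lie in the first `n` of the closed sets `X k` only; it is their weak limits
that live on the intersection. -/
theorem exists_uniform_coding {ν : Measure (FullShift K)} [IsProbabilityMeasure ν]
    (hν : Ergodic (shift K) ν) {ε : ℝ} (hε : 0 < ε) :
    ∃ (N : ℕ → ℕ) (Φ : ℕ → FullShift K → FullShift K) (X : ℕ → Set (FullShift K)),
      (∀ n, 0 < N n) ∧ Tendsto N atTop atTop ∧ (∀ n, Measurable (Φ n)) ∧
      (∀ n, ∫ x, mismatch (N n) x (Φ n x) ∂ν ≤ ε * N n) ∧ (∀ k, IsClosed (X k)) ∧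
      {ρ | IsShiftInvariant ρ ∧ ρ (⋂ k, X k)ᶜ = 0}.Subsingleton ∧
      ∀ k n, k < n → ∀ x a, (shift K)^[a] (Φ n x) ∈ X k := by
  obtain ⟨w, hw⟩ : ∃ w : ℕ → Word K, Function.Surjective w :=
    have : Nonempty (Word K) := ⟨⟨0, Fin.elim0⟩⟩
    exists_surjective_nat _
  obtain ⟨δ, hδ0, c, hδc, hc⟩ := posSumOfEncodable (lt_min (div_pos hε three_pos) one_pos) ℕ
  have hδ1 (n : ℕ) : δ n ≤ 1 :=
    (le_hasSum hδc n fun k _ => (hδ0 k).le).trans (hc.trans (min_le_right _ _))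
  have hδlim : Tendsto δ atTop (𝓝 0) := hδc.summable.tendsto_atTop_zero
  obtain ⟨S, p, hS⟩ := BlockCode.exists_isRefiningSequence hν w hδ0 hδ1
  let η : ℕ → ℝ := fun k => 3 * δ k + δ (k + 1)
  let R : ∀ k, Fin k → ℝ := fun k j => (η k + 2 * (1 + |p k j|)) * (3 * (S (k + 1)).len : ℕ)
  have hη : Tendsto η atTop (𝓝 0) := by
    have h := (hδlim.const_mul 3).add (hδlim.comp (tendsto_add_atTop_nat 1))
    rwa [mul_zero, add_zero] at h
  refine ⟨fun n => (S n).len, fun n => (S n).periodicCode,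
    fun k => frequencySet (fun j : Fin k => w j) (fun j => p k j) (R k) (η k),
    fun n => (S n).len_pos, tendsto_atTop_mono hS.le_len tendsto_id,
    fun n => (S n).measurable_periodicCode, fun n => ?_, fun k => isClosed_frequencySet _ _ _ _,
    subsingleton_invariant_of_frequencySet hw hη _ _, fun k n hkn x a j b => ?_⟩
  · rw [BlockCode.integral_mismatch_periodicCode]
    refine mul_le_mul_of_nonneg_right ((hS.err_le n).trans ?_) (Nat.cast_nonneg _)
    rw [← Finset.mul_sum, ← le_div_iff₀' three_pos]
    exact (sum_le_hasSum _ (fun k _ => (hδ0 k).le) hδc).trans (hc.trans (min_le_left _ _))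
  · exact (hS.hasFrequency k j j.2).abs_occ_sub_le (by linarith [hδ0 k]) (hδ0 _).le
      (hS.word_le (k + 1) j (by omega))
      (BlockCode.isCoded_of_le hS.refines hkn ((S n).isCoded_periodicCode x)) a b

end UniformFrequencies

section OrbitAverages

theorem continuous_birkhoffAverage {Y E : Type*} [TopologicalSpace Y] [NormedAddCommGroup E]
    [NormedSpace ℝ E] {T : Y → Y} (hT : Continuous T) {F : Y → E} (hF : Continuous F) (N : ℕ) :
    Continuous (birkhoffAverage ℝ T F N) :=
  Continuous.const_smul (continuous_finsetSum _ fun t _ => hF.comp (hT.iterate t)) (N : ℝ)⁻¹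

theorem integrable_of_continuous {Y E : Type*} [TopologicalSpace Y] [CompactSpace Y]
    [MeasurableSpace Y] [OpensMeasurableSpace Y] [NormedAddCommGroup E]
    [SecondCountableTopology E] {F : Y → E} (hF : Continuous F) (κ : Measure Y)
    [IsFiniteMeasure κ] : Integrable F κ := by
  borelize E
  exact hF.integrable_of_hasCompactSupport (.of_compactSpace F)

variable {Z : Type*} [MeasurableSpace Z] {T : Z → Z}

/-- The average `N⁻¹ ∑_{t < N} T^t κ` of the images of `κ` under the first `N` iterates of `T`.
Its limits as `N → ∞` are the invariant measures of the Krylov–Bogoliubov construction. -/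
noncomputable def orbitAverage (T : Z → Z) (κ : Measure Z) (N : ℕ) : Measure Z :=
  (N : ENNReal)⁻¹ • ∑ t ∈ Finset.range N, κ.map T^[t]

theorem orbitAverage_apply (hT : Measurable T) (κ : Measure Z) (N : ℕ) {s : Set Z}
    (hs : MeasurableSet s) :
    orbitAverage T κ N s = (N : ENNReal)⁻¹ * ∑ t ∈ Finset.range N, κ (T^[t] ⁻¹' s) := by
  simp only [orbitAverage, Measure.smul_apply, Measure.finsetSum_apply, smul_eq_mul,
    Measure.map_apply (hT.iterate _) hs]

theorem orbitAverage_compl_eq_zero (hT : Measurable T) {κ : Measure Z} {s : Set Z}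
    (hs : MeasurableSet s) (h : ∀ t, ∀ᵐ z ∂κ, T^[t] z ∈ s) (N : ℕ) :
    orbitAverage T κ N sᶜ = 0 := by
  rw [orbitAverage_apply hT κ N hs.compl, mul_eq_zero]
  exact Or.inr (Finset.sum_eq_zero fun t _ => h t)

theorem isProbabilityMeasure_orbitAverage (hT : Measurable T) (κ : Measure Z)
    [IsProbabilityMeasure κ] {N : ℕ} (hN : 0 < N) :
    IsProbabilityMeasure (orbitAverage T κ N) := by
  refine ⟨?_⟩
  simp only [orbitAverage_apply hT κ N .univ, Set.preimage_univ, measure_univ, Finset.sum_const,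
    Finset.card_range, nsmul_eq_mul, mul_one]
  exact ENNReal.inv_mul_cancel (Nat.cast_ne_zero.2 hN.ne') (ENNReal.natCast_ne_top N)

theorem orbitAverage_eq_self {κ : Measure Z} (hκ : MeasurePreserving T κ κ) {N : ℕ} (hN : 0 < N) :
    orbitAverage T κ N = κ := by
  ext s hs
  simp only [orbitAverage_apply hκ.measurable κ N hs, Finset.sum_const, Finset.card_range,
    nsmul_eq_mul, (hκ.iterate _).measure_preimage hs.nullMeasurableSet]
  rw [← mul_assoc, ENNReal.inv_mul_cancel (Nat.cast_ne_zero.2 hN.ne') (ENNReal.natCast_ne_top N),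
    one_mul]

theorem map_orbitAverage {Z' : Type*} [MeasurableSpace Z'] {T' : Z' → Z'} {p : Z → Z'}
    (hT : Measurable T) (hT' : Measurable T') (hp : Measurable p)
    (hpT : Function.Semiconj p T T') (κ : Measure Z) (N : ℕ) :
    (orbitAverage T κ N).map p = orbitAverage T' (κ.map p) N := by
  ext s hs
  rw [Measure.map_apply hp hs, orbitAverage_apply hT κ N (hp hs), orbitAverage_apply hT' _ N hs]
  congr 1
  refine Finset.sum_congr rfl fun t _ => ?_
  rw [Measure.map_apply hp (hT'.iterate t hs), ← Set.preimage_comp, ← Set.preimage_comp,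
    (hpT.iterate_right t).comp_eq]

variable {E : Type*} [NormedAddCommGroup E] [NormedSpace ℝ E]

theorem integral_orbitAverage (hT : Measurable T) {κ : Measure Z} (N : ℕ) {F : Z → E}
    (hF : ∀ t, Integrable F (κ.map T^[t])) :
    ∫ z, F z ∂(orbitAverage T κ N) = ∫ z, birkhoffAverage ℝ T F N z ∂κ := by
  simp only [orbitAverage, birkhoffAverage, birkhoffSum]
  rw [integral_smul_measure, integral_finsetSum_measure fun t _ => hF t, integral_smul,
    integral_finsetSum (f := fun t z => F (T^[t] z)) _
      fun t _ => (hF t).comp_measurable (hT.iterate t),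
    ENNReal.toReal_inv, ENNReal.toReal_natCast]
  congr 1
  exact Finset.sum_congr rfl fun t _ =>
    integral_map (hT.iterate t).aemeasurable (hF t).aestronglyMeasurable

variable [TopologicalSpace Z] [CompactSpace Z] [BorelSpace Z]

theorem integral_orbitAverage_of_continuous [SecondCountableTopology E] (hT : Continuous T)
    (κ : Measure Z) [IsFiniteMeasure κ] (N : ℕ) {F : Z → E} (hF : Continuous F) :
    ∫ z, F z ∂(orbitAverage T κ N) = ∫ z, birkhoffAverage ℝ T F N z ∂κ :=
  integral_orbitAverage hT.measurable N fun _ => integrable_of_continuous hF _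

theorem norm_integral_comp_sub_integral_orbitAverage_le [SecondCountableTopology E]
    (hT : Continuous T) (κ : Measure Z) [IsProbabilityMeasure κ] (N : ℕ) {F : Z → E}
    (hF : Continuous F) {C : ℝ} (hC : ∀ z, ‖F z‖ ≤ C) :
    ‖∫ z, F (T z) ∂(orbitAverage T κ N) - ∫ z, F z ∂(orbitAverage T κ N)‖ ≤
      (N : ℝ)⁻¹ * (2 * C) := by
  have hbound : ∀ z, ‖birkhoffAverage ℝ T (F ∘ T) N z - birkhoffAverage ℝ T F N z‖ ≤
      (N : ℝ)⁻¹ * (2 * C) := fun z => by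
    have hshift : birkhoffAverage ℝ T (F ∘ T) N z = birkhoffAverage ℝ T F N (T z) := by
      simp only [birkhoffAverage, birkhoffSum, Function.comp_apply,
        ← Function.iterate_succ_apply' T, ← Function.iterate_succ_apply T]
    rw [hshift, birkhoffAverage_apply_sub_birkhoffAverage, norm_smul, norm_inv,
      Real.norm_natCast, two_mul]
    gcongr
    exact (norm_sub_le _ _).trans (add_le_add (hC _) (hC _))
  have hcomp := integral_orbitAverage_of_continuous hT κ N (hF.comp hT)
  simp only [Function.comp_apply] at hcomp
  rw [hcomp, integral_orbitAverage_of_continuous hT κ N hF,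
    ← integral_sub (integrable_of_continuous (continuous_birkhoffAverage hT (hF.comp hT) N) κ)
      (integrable_of_continuous (continuous_birkhoffAverage hT hF N) κ)]
  simpa only [probReal_univ, mul_one] using
    norm_integral_le_of_norm_le_const (μ := κ) (ae_of_all _ hbound)

variable [HasOuterApproxClosed Z]

theorem measurePreserving_of_tendsto_orbitAverage {ι : Type*} {L : Filter ι} [L.NeBot]
    (hT : Continuous T) {κ : ι → Measure Z} [∀ i, IsProbabilityMeasure (κ i)] {N : ι → ℕ}
    (hN : Tendsto N L atTop) {A : ι → ProbabilityMeasure Z}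
    (hA : ∀ i, (A i : Measure Z) = orbitAverage T (κ i) (N i)) {π : ProbabilityMeasure Z}
    (hπ : Tendsto A L (𝓝 π)) : MeasurePreserving T (π : Measure Z) π := by
  refine ⟨hT.measurable, ext_of_forall_integral_eq_of_IsFiniteMeasure fun F => ?_⟩
  have hlim := ProbabilityMeasure.tendsto_iff_forall_integral_tendsto.1 hπ
  have hdiff := (hlim (F.compContinuous ⟨T, hT⟩)).sub (hlim F)
  simp only [hA, BoundedContinuousFunction.compContinuous_apply, ContinuousMap.coe_mk] at hdiff
  have hzero : Tendsto (fun i => (N i : ℝ)⁻¹ * (2 * ‖F‖)) L (𝓝 0) := by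
    simpa only [zero_mul, Function.comp_apply] using (tendsto_inv_atTop_zero.comp
      (tendsto_natCast_atTop_atTop.comp hN)).mul_const (2 * ‖F‖)
  rw [integral_map hT.aemeasurable F.continuous.aestronglyMeasurable]
  exact sub_eq_zero.1 (tendsto_nhds_unique hdiff (squeeze_zero_norm (fun i =>
    norm_integral_comp_sub_integral_orbitAverage_le hT (κ i) (N i) F.continuous
      F.norm_coe_le_norm) hzero))

theorem exists_tendsto_orbitAverage [T2Space Z] (hT : Continuous T) (κ : ℕ → Measure Z)
    [∀ n, IsProbabilityMeasure (κ n)] {N : ℕ → ℕ} (hN0 : ∀ n, 0 < N n)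
    (hN : Tendsto N atTop atTop) :
    ∃ (A : ℕ → ProbabilityMeasure Z) (π : ProbabilityMeasure Z) (U : Ultrafilter ℕ),
      (∀ n, (A n : Measure Z) = orbitAverage T (κ n) (N n)) ∧ (U : Filter ℕ) ≤ atTop ∧
        Tendsto A U (𝓝 π) ∧ MeasurePreserving T (π : Measure Z) π := by
  let A : ℕ → ProbabilityMeasure Z := fun n =>
    ⟨orbitAverage T (κ n) (N n), isProbabilityMeasure_orbitAverage hT.measurable (κ n) (hN0 n)⟩
  obtain ⟨U, hU⟩ := Ultrafilter.exists_le (atTop : Filter ℕ)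
  have hlim : Tendsto A U (𝓝 (U.map A).lim) := (U.map A).le_nhds_lim
  exact ⟨A, _, U, fun _ => rfl, hU, hlim,
    measurePreserving_of_tendsto_orbitAverage hT (hN.mono_left hU) (fun _ => rfl) hlim⟩

theorem measure_compl_eq_zero_of_tendsto {Y : Type*} [MeasurableSpace Y] [TopologicalSpace Y]
    [OpensMeasurableSpace Y] [HasOuterApproxClosed Y] {ι : Type*} {L : Filter ι} [L.NeBot]
    {A : ι → ProbabilityMeasure Y} {π : ProbabilityMeasure Y} (hπ : Tendsto A L (𝓝 π))
    {C : Set Y} (hC : IsClosed C) (hAC : ∀ᶠ i in L, (A i : Measure Y) Cᶜ = 0) :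
    (π : Measure Y) Cᶜ = 0 := by
  have hone : (fun i => (A i : Measure Y) C) =ᶠ[L] fun _ => 1 :=
    hAC.mono fun i hi => (prob_compl_eq_zero_iff hC.measurableSet).1 hi
  have hlimsup := ProbabilityMeasure.limsup_measure_closed_le_of_tendsto hπ hC
  rw [limsup_congr hone, limsup_const] at hlimsup
  exact (prob_compl_eq_zero_iff hC.measurableSet).2 (le_antisymm prob_le_one hlimsup)

end OrbitAverages

section StrictErgodicity

variable {K : Finset ℂ}

theorem mapsTo_support_of_measurePreserving {Y : Type*} [TopologicalSpace Y] [MeasurableSpace Y]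
    [OpensMeasurableSpace Y] {T : Y → Y} (hT : Continuous T) {ρ : Measure Y}
    (hρ : MeasurePreserving T ρ ρ) : Set.MapsTo T ρ.support ρ.support := by
  intro x hx
  rw [Measure.mem_support_iff_forall] at hx ⊢
  intro V hV
  obtain ⟨W, hWV, hW, hxW⟩ := mem_nhds_iff.1 hV
  calc
    0 < ρ (T ⁻¹' W) := hx _ (hT.continuousAt.preimage_mem_nhds (hW.mem_nhds hxW))
    _ = ρ W := hρ.measure_preimage hW.measurableSet.nullMeasurableSet
    _ ≤ ρ V := measure_mono hWV

theorem IsSubshift.exists_isShiftInvariant {Y : Set (FullShift K)} (hY : IsSubshift Y) :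
    ∃ ρ : Measure (FullShift K), IsShiftInvariant ρ ∧ ρ Yᶜ = 0 := by
  obtain ⟨y, hy⟩ := hY.nonempty
  obtain ⟨A, π, U, hA, -, hlim, hπ⟩ := exists_tendsto_orbitAverage (continuous_shift (K := K))
    (fun _ => Measure.dirac y) Nat.succ_pos (tendsto_add_atTop_nat 1)
  refine ⟨π, ⟨inferInstance, hπ⟩,
    measure_compl_eq_zero_of_tendsto hlim hY.isClosed (.of_forall fun n => ?_)⟩
  rw [hA]
  refine orbitAverage_compl_eq_zero measurable_shift hY.isClosed.measurableSet (fun t => ?_) _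
  rw [ae_dirac_iff (measurable_shift.iterate t hY.isClosed.measurableSet)]
  exact hY.mapsTo.iterate t hy

theorem isStrictlyErgodicMeasure_of_subsingleton {ρ : Measure (FullShift K)}
    (hρ : IsShiftInvariant ρ) {X : Set (FullShift K)} (hX : IsClosed X) (hρX : ρ Xᶜ = 0)
    (huniq : {ρ' | IsShiftInvariant ρ' ∧ ρ' Xᶜ = 0}.Subsingleton) :
    IsStrictlyErgodicMeasure ρ := by
  have := hρ.isProbabilityMeasure
  have hsupp : IsSubshift ρ.support :=
    ⟨Measure.nonempty_support (IsProbabilityMeasure.ne_zero ρ), Measure.isClosed_support,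
      mapsTo_support_of_measurePreserving continuous_shift hρ.measurePreserving⟩
  have hunique : ∀ ρ', IsShiftInvariant ρ' → ρ' ρ.supportᶜ = 0 → ρ' = ρ := fun ρ' hρ' hnull =>
    huniq ⟨hρ', measure_mono_null
      (Set.compl_subset_compl.2 (Measure.support_subset_of_isClosed hX hρX)) hnull⟩ ⟨hρ, hρX⟩
  refine ⟨hρ, hsupp, fun Y hY hYsupp => ?_, ρ, ⟨hρ, Measure.measure_compl_support⟩,
    fun ρ' hρ' => hunique ρ' hρ'.1 hρ'.2⟩
  obtain ⟨ρ', hρ', hnull⟩ := hY.exists_isShiftInvariant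
  obtain rfl := hunique ρ' hρ' (measure_mono_null (Set.compl_subset_compl.2 hYsupp) hnull)
  exact hYsupp.antisymm (Measure.support_subset_of_isClosed hY.isClosed hnull)

theorem IsStrictlyErgodicMeasure.isErgodicMeasure {ν : Measure (FullShift K)}
    (hν : IsStrictlyErgodicMeasure ν) : IsErgodicMeasure ν := by
  have hinv := hν.isShiftInvariant
  refine ⟨hinv, .of_mem_extremePoints (mem_extremePoints_iff_left.2
    ⟨⟨hinv.measurePreserving, hinv.isProbabilityMeasure⟩, ?_⟩)⟩
  rintro ν₁ ⟨hν₁, hprob⟩ ν₂ - ⟨a, b, ha, -, -, hsum⟩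
  have hac : ν₁ ≪ ν := hsum ▸ (Measure.absolutelyContinuous_smul ha.ne').trans
    (Measure.absolutelyContinuous_of_le (Measure.le_add_right le_rfl))
  exact hν.support.uniquelyErgodic.unique ⟨⟨hprob, hν₁⟩, hac Measure.measure_compl_support⟩
    ⟨hinv, Measure.measure_compl_support⟩

end StrictErgodicity

section Joinings

variable {K : Finset ℂ} {μ ν : Measure (FullShift K)} {ξ : Measure (FullShift K × FullShift K)}

-- Instance search does not find `Prod.borelSpace` here.
instance : BorelSpace (FullShift K × FullShift K) := Prod.borelSpace

theorem continuous_shift_prodMap_shift : Continuous (Prod.map (shift K) (shift K)) :=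
  continuous_shift.prodMap continuous_shift

theorem IsJoining.isShiftInvariant_fst (hξ : IsJoining ξ μ ν) : IsShiftInvariant μ := by
  have := hξ.isProbabilityMeasure
  have hfst : MeasurePreserving Prod.fst ξ μ := ⟨measurable_fst, hξ.map_fst⟩
  exact ⟨hξ.map_fst ▸ Measure.isProbabilityMeasure_map measurable_fst.aemeasurable,
    hfst.of_semiconj hξ.measurePreserving (fun _ => rfl) measurable_shift⟩

theorem IsJoining.isShiftInvariant_snd (hξ : IsJoining ξ μ ν) : IsShiftInvariant ν := by
  have := hξ.isProbabilityMeasure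
  have hsnd : MeasurePreserving Prod.snd ξ ν := ⟨measurable_snd, hξ.map_snd⟩
  exact ⟨hξ.map_snd ▸ Measure.isProbabilityMeasure_map measurable_snd.aemeasurable,
    hsnd.of_semiconj hξ.measurePreserving (fun _ => rfl) measurable_shift⟩

theorem norm_integral_orbitAverage_recode_sub_le [IsProbabilityMeasure ξ]
    (hξ : MeasurePreserving (Prod.map (shift K) (shift K)) ξ ξ) {Φ : FullShift K → FullShift K}
    (hΦ : Measurable Φ) {N : ℕ} (hN : 0 < N) {F : FullShift K × FullShift K → ℂ}
    (hF : Continuous F) {C : ℝ}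
    (hFC : ∀ y x x', ‖F (y, x') - F (y, x)‖ ≤ C * mismatchInd (x, x')) :
    ‖∫ p, F p ∂(orbitAverage (Prod.map (shift K) (shift K)) (ξ.map (Prod.map id Φ)) N) -
      ∫ p, F p ∂ξ‖ ≤ C * ((N : ℝ)⁻¹ * ∫ x, mismatch N x (Φ x) ∂(ξ.map Prod.snd)) := by
  set S := Prod.map (shift K) (shift K)
  have hG : Measurable (Prod.map id Φ : FullShift K × FullShift K → _) := measurable_id.prodMap hΦ
  have hB : Continuous (birkhoffAverage ℝ S F N) :=
    continuous_birkhoffAverage continuous_shift_prodMap_shift hF N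
  have hmismatch : Measurable fun x => mismatch N x (Φ x) :=
    (measurable_mismatch N).comp (measurable_id.prodMk hΦ)
  have hBG : Integrable (fun p => birkhoffAverage ℝ S F N (Prod.map id Φ p)) ξ :=
    (integrable_of_continuous hB _).comp_measurable hG
  have hself : ∫ p, F p ∂ξ = ∫ p, birkhoffAverage ℝ S F N p ∂ξ := by
    rw [← integral_orbitAverage_of_continuous continuous_shift_prodMap_shift ξ N hF,
      orbitAverage_eq_self hξ hN]
  have hpoint : ∀ p, ‖birkhoffAverage ℝ S F N (Prod.map id Φ p) - birkhoffAverage ℝ S F N p‖ ≤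
      C * ((N : ℝ)⁻¹ * mismatch N p.2 (Φ p.2)) := fun p => by
    rw [birkhoffAverage, birkhoffAverage, ← smul_sub, norm_smul, norm_inv, Real.norm_natCast,
      mul_left_comm, birkhoffSum, birkhoffSum, ← Finset.sum_sub_distrib, mismatch_eq_sum,
      Finset.mul_sum]
    gcongr
    refine norm_sum_le_of_le _ fun t _ => ?_
    simpa only [S, Prod.map_iterate, Prod.map, id] using hFC _ _ _
  rw [integral_orbitAverage_of_continuous continuous_shift_prodMap_shift _ N hF,
    integral_map hG.aemeasurable hB.aestronglyMeasurable, hself,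
    ← integral_sub hBG (integrable_of_continuous hB ξ),
    integral_map measurable_snd.aemeasurable hmismatch.aestronglyMeasurable,
    ← integral_const_mul, ← integral_const_mul]
  refine norm_integral_le_of_norm_le (.const_mul (.const_mul ?_ _) _) (ae_of_all _ hpoint)
  exact .of_mem_Icc 0 N (hmismatch.comp measurable_snd).aemeasurable
    (ae_of_all _ fun p => mismatch_mem_Icc N _ _)

theorem IsJoining.map_fst_orbitAverage_recode (hξ : IsJoining ξ μ ν) {Φ : FullShift K → FullShift K}
    (hΦ : Measurable Φ) {N : ℕ} (hN : 0 < N) :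
    (orbitAverage (Prod.map (shift K) (shift K)) (ξ.map (Prod.map id Φ)) N).map Prod.fst = μ := by
  have hfst : (ξ.map (Prod.map id Φ)).map Prod.fst = μ := by
    rw [Measure.map_map measurable_fst (measurable_id.prodMap hΦ), ← hξ.map_fst]
    rfl
  rw [map_orbitAverage continuous_shift_prodMap_shift.measurable measurable_shift measurable_fst
    (fun _ => rfl), hfst, orbitAverage_eq_self hξ.isShiftInvariant_fst.measurePreserving hN]

theorem IsJoining.map_snd_orbitAverage_recode (hξ : IsJoining ξ μ ν) {Φ : FullShift K → FullShift K}
    (hΦ : Measurable Φ) (N : ℕ) :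
    (orbitAverage (Prod.map (shift K) (shift K)) (ξ.map (Prod.map id Φ)) N).map Prod.snd =
      orbitAverage (shift K) (ν.map Φ) N := by
  have hsnd : (ξ.map (Prod.map id Φ)).map Prod.snd = ν.map Φ := by
    rw [Measure.map_map measurable_snd (measurable_id.prodMap hΦ), ← hξ.map_snd,
      Measure.map_map hΦ measurable_snd]
    rfl
  rw [map_orbitAverage continuous_shift_prodMap_shift.measurable measurable_shift measurable_snd
    (fun _ => rfl), hsnd]

theorem exists_isJoining_limit (hξ : IsJoining ξ μ ν) {N : ℕ → ℕ} (hN0 : ∀ n, 0 < N n)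
    (hN : Tendsto N atTop atTop) {Φ : ℕ → FullShift K → FullShift K} (hΦ : ∀ n, Measurable (Φ n)) :
    ∃ (π : Measure (FullShift K × FullShift K)) (U : Ultrafilter ℕ),
      IsJoining π μ (π.map Prod.snd) ∧
      (∀ X, IsClosed X → (∀ᶠ n in atTop, ∀ x a, (shift K)^[a] (Φ n x) ∈ X) →
        π.map Prod.snd Xᶜ = 0) ∧
      ∀ F : FullShift K × FullShift K → ℂ, Continuous F → Tendsto (fun n => ∫ p, F p
        ∂(orbitAverage (Prod.map (shift K) (shift K)) (ξ.map (Prod.map id (Φ n))) (N n)))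
        U (𝓝 (∫ p, F p ∂π)) := by
  have := hξ.isProbabilityMeasure
  have hG : ∀ n, Measurable (Prod.map id (Φ n) : FullShift K × FullShift K → _) := fun n =>
    measurable_id.prodMap (hΦ n)
  have hκ : ∀ n, IsProbabilityMeasure (ξ.map (Prod.map id (Φ n))) := fun n =>
    Measure.isProbabilityMeasure_map (hG n).aemeasurable
  obtain ⟨A, π, U, hA, hU, hlim, hπ⟩ :=
    exists_tendsto_orbitAverage (continuous_shift_prodMap_shift (K := K))
      (fun n => ξ.map (Prod.map id (Φ n))) hN0 hN
  refine ⟨π, U, ⟨inferInstance, hπ, ?_, rfl⟩, fun X hX hev => ?_, fun F hF => ?_⟩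
  · let μ' : ProbabilityMeasure (FullShift K) :=
      ⟨μ, hξ.isShiftInvariant_fst.isProbabilityMeasure⟩
    have hmap := ProbabilityMeasure.tendsto_map_of_tendsto_of_continuous A π hlim continuous_fst
    have hconst : ∀ n, (A n).map continuous_fst.measurable.aemeasurable = μ' := fun n =>
      Subtype.ext ((congrArg _ (hA n)).trans (hξ.map_fst_orbitAverage_recode (hΦ n) (hN0 n)))
    simp only [hconst] at hmap
    have hmapπ := tendsto_nhds_unique hmap tendsto_const_nhds
    exact congrArg Subtype.val hmapπ
  · refine measure_compl_eq_zero_of_tendsto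
      (ProbabilityMeasure.tendsto_map_of_tendsto_of_continuous A π hlim continuous_snd) hX
      ((hev.filter_mono hU).mono fun n hn => ?_)
    rw [ProbabilityMeasure.toMeasure_map, hA, hξ.map_snd_orbitAverage_recode (hΦ n)]
    refine orbitAverage_compl_eq_zero measurable_shift hX.measurableSet (fun t => ?_) _
    rw [ae_map_iff (hΦ n).aemeasurable (measurable_shift.iterate t hX.measurableSet)]
    exact ae_of_all _ fun x => hn x t
  · simpa only [hA, BoundedContinuousFunction.mkOfCompact_apply, ContinuousMap.coe_mk] using
      (ProbabilityMeasure.tendsto_iff_forall_integral_rclike_tendsto ℂ).1 hlim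
        (BoundedContinuousFunction.mkOfCompact ⟨F, hF⟩)

theorem exists_pos_norm_sub_le_mul_mismatchInd {F : FullShift K × FullShift K → ℂ}
    (hF : Continuous F) (hF0 : ∀ y x x', x 0 = x' 0 → F (y, x) = F (y, x')) :
    ∃ C > 0, ∀ y x x', ‖F (y, x') - F (y, x)‖ ≤ C * mismatchInd (x, x') := by
  obtain ⟨M, hM⟩ := isCompact_univ.exists_bound_of_continuousOn hF.continuousOn
  refine ⟨2 * max M 1, by positivity, fun y x x' => ?_⟩
  by_cases h : x 0 = x' 0
  · rw [hF0 y x x' h, sub_self, norm_zero]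
    exact mul_nonneg (by positivity) (mismatchInd_mem_Icc _).1
  · rw [mismatchInd, Set.indicator_of_mem (by exact h), Pi.one_apply, mul_one, two_mul]
    exact (norm_sub_le _ _).trans (add_le_add ((hM _ trivial).trans (le_max_left _ _))
      ((hM _ trivial).trans (le_max_left _ _)))

theorem IsJoining.exists_isStrictlyErgodicMeasure (hξ : IsJoining ξ μ ν)
    (hν : Ergodic (shift K) ν) {F : FullShift K × FullShift K → ℂ} (hF : Continuous F)
    (hF0 : ∀ y x x', x 0 = x' 0 → F (y, x) = F (y, x')) {ε : ℝ} (hε : 0 < ε) :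
    ∃ ρ π, IsStrictlyErgodicMeasure ρ ∧ IsJoining π μ ρ ∧ ‖∫ p, F p ∂π - ∫ p, F p ∂ξ‖ ≤ ε := by
  have := hξ.isProbabilityMeasure
  have := hξ.isShiftInvariant_snd.isProbabilityMeasure
  obtain ⟨C, hC, hFC⟩ := exists_pos_norm_sub_le_mul_mismatchInd hF hF0
  obtain ⟨N, Φ, X, hN0, hN, hΦ, hmismatch, hX, hunique, hΦX⟩ :=
    exists_uniform_coding hν (div_pos hε hC)
  obtain ⟨π, U, hπ, hsupp, hlim⟩ := exists_isJoining_limit hξ hN0 hN hΦ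
  have hclose (n : ℕ) : (N n : ℝ)⁻¹ * ∫ x, mismatch (N n) x (Φ n x) ∂(ξ.map Prod.snd) ≤ ε / C := by
    rw [hξ.map_snd, inv_mul_le_iff₀ (Nat.cast_pos.2 (hN0 n)), mul_comm]
    exact hmismatch n
  have hnull : π.map Prod.snd (⋂ k, X k)ᶜ = 0 := by
    rw [Set.compl_iInter, measure_iUnion_null_iff]
    exact fun k => hsupp _ (hX k) ((eventually_gt_atTop k).mono fun n hn => hΦX k n hn)
  refine ⟨π.map Prod.snd, π, isStrictlyErgodicMeasure_of_subsingleton hπ.isShiftInvariant_snd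
    (isClosed_iInter hX) hnull hunique, hπ,
    le_of_tendsto ((hlim F hF).sub_const _).norm (.of_forall fun n => ?_)⟩
  calc
    _ ≤ C * ((N n : ℝ)⁻¹ * ∫ x, mismatch (N n) x (Φ n x) ∂(ξ.map Prod.snd)) :=
      norm_integral_orbitAverage_recode_sub_le hξ.measurePreserving (hΦ n) (hN0 n) hF hFC
    _ ≤ C * (ε / C) := by gcongr; exact hclose n
    _ = ε := mul_div_cancel₀ ε hC.ne'

end Joinings

section Correlation

variable {K : Finset ℂ} {μ ν : Measure (FullShift K)}

/-- The function `(x, y) ↦ (x₁ - m) conj(y₁)`. With `m = ∫ x₁ dμ`, its integral over a joining of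
`μ` and `ν` is the quantity whose absolute value enters the correlation of `μ` and `ν`. -/
noncomputable def centeredProduct (m : ℂ) (p : FullShift K × FullShift K) : ℂ :=
  ((p.1 0 : ℂ) - m) * (starRingEnd ℂ) (p.2 0 : ℂ)

theorem continuous_symbol : Continuous fun z : FullShift K => (z 0 : ℂ) :=
  continuous_subtype_val.comp (continuous_apply 0)

theorem continuous_conj_symbol : Continuous fun z : FullShift K => (starRingEnd ℂ) (z 0 : ℂ) :=
  Complex.continuous_conj.comp continuous_symbol

theorem continuous_centeredProduct (m : ℂ) : Continuous (centeredProduct (K := K) m) :=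
  ((continuous_symbol.comp continuous_fst).sub continuous_const).mul
    (continuous_conj_symbol.comp continuous_snd)

theorem IsJoining.integral_centeredProduct {ξ : Measure (FullShift K × FullShift K)}
    (hξ : IsJoining ξ μ ν) (m : ℂ) :
    ∫ p, centeredProduct m p ∂ξ = (∫ p, (p.1 0 : ℂ) * (starRingEnd ℂ) (p.2 0 : ℂ) ∂ξ) -
      m * ∫ y, (starRingEnd ℂ) (y 0 : ℂ) ∂ν := by
  have := hξ.isProbabilityMeasure
  have hconj : Continuous fun p : FullShift K × FullShift K => (starRingEnd ℂ) (p.2 0 : ℂ) :=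
    continuous_conj_symbol.comp continuous_snd
  have hprod : Integrable (fun p => (p.1 0 : ℂ) * (starRingEnd ℂ) (p.2 0 : ℂ)) ξ :=
    integrable_of_continuous ((continuous_symbol.comp continuous_fst).mul hconj) ξ
  simp only [centeredProduct, sub_mul]
  rw [integral_sub hprod ((integrable_of_continuous hconj ξ).const_mul m), integral_const_mul,
    ← hξ.map_snd,
    integral_map measurable_snd.aemeasurable continuous_conj_symbol.aestronglyMeasurable]

theorem correlated_iff_exists_isJoining :
    Correlated μ ν ↔
      ∃ ξ, IsJoining ξ μ ν ∧ ∫ p, centeredProduct (∫ x, (x 0 : ℂ) ∂μ) p ∂ξ ≠ 0 := by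
  set m := ∫ x, (x 0 : ℂ) ∂μ
  have hcorr : corr μ ν = ⨆ ξ : {ξ // IsJoining ξ μ ν}, ‖∫ p, centeredProduct m p ∂ξ.1‖ :=
    iSup_congr fun ξ => congrArg norm (ξ.2.integral_centeredProduct m).symm
  have hbdd : BddAbove (Set.range fun ξ : {ξ // IsJoining ξ μ ν} =>
      ‖∫ p, centeredProduct m p ∂ξ.1‖) := by
    obtain ⟨C, hC⟩ := isCompact_univ.exists_bound_of_continuousOn
      (continuous_centeredProduct (K := K) m).continuousOn
    refine ⟨C, Set.forall_mem_range.2 fun ξ => ?_⟩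
    have := ξ.2.isProbabilityMeasure
    simpa only [probReal_univ, mul_one] using
      norm_integral_le_of_norm_le_const (μ := ξ.1) (ae_of_all _ fun p => hC p trivial)
  rw [Correlated, hcorr]
  refine ⟨fun h => ?_, fun ⟨ξ, hξ, hne⟩ =>
    ((norm_pos_iff.2 hne).trans_le (le_ciSup hbdd ⟨ξ, hξ⟩)).ne'⟩
  contrapose! h
  exact (iSup_congr fun ξ : {ξ // IsJoining ξ μ ν} => norm_eq_zero.2 (h ξ.1 ξ.2)).trans
    Real.iSup_const_zero

end Correlation

theorem theorem2p2_general (K : Finset ℂ) (μ : Measure (FullShift K)) (_hμ : IsShiftInvariant μ) :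
    (∃ ν : Measure (FullShift K), IsStrictlyErgodicMeasure ν ∧ Correlated μ ν) ↔
      (∃ ν : Measure (FullShift K), IsErgodicMeasure ν ∧ Correlated μ ν) := by
  refine ⟨fun ⟨ν, hν, hcorr⟩ => ⟨ν, hν.isErgodicMeasure, hcorr⟩, ?_⟩
  rintro ⟨ν, hν, hcorr⟩
  obtain ⟨ξ, hξ, hne⟩ := correlated_iff_exists_isJoining.1 hcorr
  obtain ⟨ρ, π, hρ, hπ, hclose⟩ := hξ.exists_isStrictlyErgodicMeasure hν.ergodic
    (continuous_centeredProduct _) (fun y x x' h => by simp only [centeredProduct, h])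
    (half_pos (norm_pos_iff.2 hne))
  refine ⟨ρ, hρ, correlated_iff_exists_isJoining.2 ⟨π, hπ, fun hzero => ?_⟩⟩
  rw [hzero, zero_sub, norm_neg] at hclose
  exact (half_lt_self (norm_pos_iff.2 hne)).not_ge hclose

theorem theorem2p2 (K : Finset ℂ) (hK : ∀ z ∈ K, ‖z‖ ≤ 1)
    (μ : Measure (FullShift K)) (hμ : IsShiftInvariant μ) :
    (∃ ν : Measure (FullShift K), IsStrictlyErgodicMeasure ν ∧ Correlated μ ν) ↔
      (∃ ν : Measure (FullShift K), IsErgodicMeasure ν ∧ Correlated μ ν) :=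
  theorem2p2_general K μ hμ
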